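/- Let $K$ be a field. For a square matrix $A\in K^{s\times s}$ let $I_A\subseteq K[x_1,\dots,x_s]$ be the ideal generated by the $2\times 2$ minors of the augmented matrix $(A\boldsymbol x\mid \boldsymbol x)$, where $\boldsymbol x=(x_1,\dots,x_s)^T$; it defines the eigenscheme of $A$. Let $J_{\lambda,r}$ denote the $r\times r$ Jordan block with eigenvalue $\lambda$ (ones on the superdiagonal) and $kJ_{\lambda,r}$ the direct sum of $k$ copies of it. Let $n\ge 1$, let $\lambda_1,\dots,\lambda_n\in K$ be pairwise distinct and, for each $i$, let $\ell_i\ge 1$, $k^{(i)}_1,\dots,k^{(i)}_{\ell_i}\ge 1$ and $r^{(i)}_1>\dots>r^{(i)}_{\ell_i}\ge 1$ be integers. Put $$J_{\lambda_i}=\bigoplus_{j=1}^{\ell_i}k^{(i)}_jJ_{\lambda_i,r^{(i)}_j},\qquad J=J_{\lambda_1\cdots\lambda_n}=\bigoplus_{i=1}^n J_{\lambda_i}.$$ Write $x^{(i)}(a,b,c)$ ($1\le a\le \ell_i$, $1\le b\le k^{(i)}_a$, $1\le c\le r^{(i)}_a$) for the variable that belongs to row $c$ of the $b$-th block of size $r^{(i)}_a$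 with eigenvalue $\lambda_i$, let $R_i$ be the polynomial ring over $K$ in the variables $x^{(i)}(a,b,c)$ for fixed $i$, and $R$ the polynomial ring in all of them. Let $\mathfrak p_i\subseteq R$ be the ideal generated by the variables $x^{(i')}(a,b,c)$ with $i'\ne i$, and let $$\mathfrak q_{\lambda_i,j}=I_{J_{\lambda_i}}+\langle x^{(i)}(a,b,c)\mid a\le j,\ c>r^{(i)}_j\rangle+\langle x^{(i)}(a,b,c)\mid a>j\rangle\subseteq R_i .$$ (1) The ideals $Q_{i,j}=\langle\mathfrak q_{\lambda_i,j}\rangle+\mathfrak p_i$ form an irredundant primary decomposition $$I_J=\bigcap_{i=1}^n\bigcap_{j=1}^{\ell_i}\bigl(\langle\mathfrak q_{\lambda_i,j}\rangle+\mathfrak p_i\bigr),$$ that is, they are primary, none contains the intersection of the others, and their radicals are pairwise distinct. (2) The ideals $Q_{i,j}$ are homogeneous, and for all $i,j$ the Hilbert functions satisfy $H_{R/Q_{i,j}}(t)=H_{R_i/\mathfrak q_{\lambda_i,j}}(t)$ for all $t\ge 0$; this value is $1$ for $t=0$, and for all $t\ge 1$ it is $$r^{(i)}_j\binom{t+k^{(i)}_1+\dots+k^{(i)}_j-1}{t}.$$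 (3) The primary decomposition of the eigenscheme determines the Jordan canonical form, up to the values and the order of the eigenvalues, in the following sense. Two components $Q_{i,j}$ and $Q_{i',j'}$ have comparable radicals (one contains the other) if and only if $i=i'$. If $A\in K^{s\times s}$ and $P^{-1}AP=J$, then the ideals $Q^A_{i,j}$ obtained from the $Q_{i,j}$ by the linear change of variables given by $P$ form an irredundant primary decomposition of $I_A$, with the same Hilbert functions. Finally, let $A'\in K^{s'\times s'}$ be another matrix that is similar to a Jordan matrix $J'$, with data $n',\lambda'_i,\ell'_i,k'^{(i)}_j,r'^{(i)}_j$ and components $Q^{A'}_{i,j}$, and let $e$ be a bijection from the components of $I_A$ to those of $I_{A'}$ such that corresponding components have the same Hilbert function, and two components of $I_A$ have comparable radicals if and only if the corresponding components of $I_{A'}$ do. Then there is a bijection $\sigma:\{1,\dots,n\}\to\{1,\dots,n'\}$ such that $\ell_i=\ell'_{\sigma(i)}$, $k^{(i)}_j=k'^{(\sigma(i))}_j$, $r^{(i)}_j=r'^{(\sigma(i))}_j$ and $e$ maps the component $(i,j)$ to $(\sigma(i),j)$ for all $i,j$; if moreover $\lambda'_{\sigma(i)}=\lambda_i$ for all $i$,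 then $J'$ is obtained from $J$ by a simultaneous permutation of rows and columns. -/

import Mathlib

open MvPolynomial

noncomputable section

namespace Eigenscheme

/-- The augmented matrix `(A x | x)`, with `x` the column vector of the variables. -/
def augmented {K ι : Type*} [Field K] [Fintype ι] (A : Matrix ι ι K) :
    Matrix ι (Fin 2) (MvPolynomial ι K) :=
  Matrix.of fun i => ![∑ j, C (A i j) * X j, X i]

/-- The ideal `I_A` of the eigenscheme of `A`: it is generated by the `2 × 2` minors of the
augmented matrix `(A x | x)`. -/
def eigenIdeal {K ι : Type*} [Field K] [Fintype ι] (A : Matrix ι ι K) :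
    Ideal (MvPolynomial ι K) :=
  Ideal.span (Set.range fun p : ι × ι =>
    ((augmented A).submatrix ![p.1, p.2] id).det)

/-- The Jordan block of size `m` with eigenvalue `lam` (ones on the superdiagonal). -/
def jordanBlock {K : Type*} [Field K] (lam : K) (m : ℕ) : Matrix (Fin m) (Fin m) K :=
  Matrix.of fun a b => if a = b then lam else if (a : ℕ) + 1 = b then 1 else 0

/-- The block structure of a Jordan matrix with a single eigenvalue: `k a` blocks of
size `r a` for each `a`, with `r` strictly decreasing. Indices start at `0`. -/
structure BlockType where
  len : ℕ
  k : Fin len → ℕ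
  r : Fin len → ℕ
  len_pos : 0 < len
  k_pos : ∀ a, 0 < k a
  r_pos : ∀ a, 0 < r a
  r_anti : StrictAnti r

namespace BlockType

/-- The individual Jordan blocks: pairs (size class, copy). -/
abbrev Block (S : BlockType) : Type := Σ a : Fin S.len, Fin (S.k a)

/-- The variables: `⟨⟨a, b⟩, c⟩` is the `c`-th row of the `b`-th block of size `r a`. -/
abbrev Index (S : BlockType) : Type := Σ b : S.Block, Fin (S.r b.1)

/-- The Jordan matrix `⨁ a, k a • J_{lam, r a}` with the single eigenvalue `lam`. -/
def matrix {K : Type*} [Field K] (S : BlockType) (lam : K) : Matrix S.Index S.Index K :=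
  Matrix.blockDiagonal' fun b : S.Block => jordanBlock lam (S.r b.1)

/-- The variables of blocks of size at least `r j` that lie beyond the first `r j` rows. -/
def tailVars (S : BlockType) (j : Fin S.len) : Set S.Index :=
  {v | v.1.1 ≤ j ∧ S.r j ≤ (v.2 : ℕ)}

/-- The variables of blocks of size less than `r j`. -/
def smallVars (S : BlockType) (j : Fin S.len) : Set S.Index :=
  {v | j < v.1.1}

/-- The ideal `𝔮_{lam, j}`. -/
def q (K : Type*) [Field K] (S : BlockType) (lam : K) (j : Fin S.len) :
    Ideal (MvPolynomial S.Index K) :=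
  eigenIdeal (S.matrix lam) ⊔
    (Ideal.span (X '' S.tailVars j) ⊔ Ideal.span (X '' S.smallVars j))

end BlockType

/-- The data of a Jordan matrix: its distinct eigenvalues (at least one), each with its block
structure. -/
structure JordanData (K : Type*) [Field K] where
  n : ℕ
  n_pos : 0 < n
  eigenvalue : Fin n → K
  eigenvalue_injective : Function.Injective eigenvalue
  type : Fin n → BlockType

namespace JordanData

variable {K : Type*} [Field K]

/-- The variables of all eigenvalues. -/
abbrev Index (D : JordanData K) : Type := Σ i : Fin D.n, (D.type i).Index

/-- The index set of the primary components: pairs (eigenvalue, size class). -/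
abbrev Comp (D : JordanData K) : Type := Σ i : Fin D.n, Fin (D.type i).len

/-- The Jordan matrix `J_{λ_1} ⊕ ⋯ ⊕ J_{λ_n}`. -/
def matrix (D : JordanData K) : Matrix D.Index D.Index K :=
  Matrix.blockDiagonal' fun i => (D.type i).matrix (D.eigenvalue i)

/-- The ideal `𝔭_i` generated by the variables that do not belong to the `i`-th eigenvalue. -/
def p (D : JordanData K) (i : Fin D.n) : Ideal (MvPolynomial D.Index K) :=
  Ideal.span (X '' {v : D.Index | v.1 ≠ i})

/-- The ideal `𝔮_{λ_i, j}` in the polynomial ring `R_i` of the `i`-th eigenvalue. -/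
def q (D : JordanData K) (c : D.Comp) : Ideal (MvPolynomial (D.type c.1).Index K) :=
  (D.type c.1).q K (D.eigenvalue c.1) c.2

/-- The ideal `⟨𝔮_{λ_i, j}⟩ + 𝔭_i` of the full polynomial ring. -/
def component (D : JordanData K) (c : D.Comp) : Ideal (MvPolynomial D.Index K) :=
  (D.q c).map (rename (fun v => (⟨c.1, v⟩ : D.Index)) :
    MvPolynomial (D.type c.1).Index K →ₐ[K] MvPolynomial D.Index K) ⊔ D.p c.1

end JordanData

/-- `(Q a)` is an irredundant primary decomposition of `I`: the `Q a` are primary with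
intersection `I`, none contains the intersection of the others, and their radicals are
pairwise distinct. -/
structure IsIrredundantPrimaryDecomposition {R κ : Type*} [CommRing R]
    (I : Ideal R) (Q : κ → Ideal R) : Prop where
  eq_iInf : I = ⨅ a, Q a
  primary : ∀ a, (Q a).IsPrimary
  irredundant : ∀ a, ¬ (⨅ b, ⨅ _ : b ≠ a, Q b) ≤ Q a
  radical_injective : Function.Injective fun a => (Q a).radical

/-- The ideal contains the homogeneous components of all its elements (standard grading). -/
def IsHomogeneousIdeal {K σ : Type*} [Field K] (I : Ideal (MvPolynomial σ K)) : Prop :=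
  ∀ f ∈ I, ∀ t : ℕ, homogeneousComponent t f ∈ I

/-- The Hilbert function of `K[x]/I` for a homogeneous ideal `I`: the dimension of the image of
the forms of degree `t`. -/
def hilbertFunction {K σ : Type*} [Field K] (I : Ideal (MvPolynomial σ K)) (t : ℕ) : ℕ :=
  Module.finrank K
    ((homogeneousSubmodule σ K t).map (Ideal.Quotient.mkₐ K I).toLinearMap)

/-- One of the two ideals has its radical inside that of the other. -/
def RadicalsComparable {R : Type*} [CommRing R] (I J : Ideal R) : Prop :=
  I.radical ≤ J.radical ∨ J.radical ≤ I.radical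

/-- A Jordan canonical form of a square matrix `A`: a Jordan matrix `J` and an invertible matrix
`P` with `P⁻¹ A P = J`. -/
structure JordanForm {K ι : Type*} [Field K] [Fintype ι] [DecidableEq ι]
    (A : Matrix ι ι K) where
  data : JordanData K
  P : Matrix ι data.Index K
  Pinv : Matrix data.Index ι K
  mul_inv : P * Pinv = 1
  inv_mul : Pinv * P = 1
  conj : Pinv * A * P = data.matrix

namespace JordanForm

variable {K ι : Type*} [Field K] [Fintype ι] [DecidableEq ι] {A : Matrix ι ι K}

/-- The linear change of variables `x = P y`. -/
def changeOfVars (F : JordanForm A) : MvPolynomial ι K →ₐ[K] MvPolynomial F.data.Index K :=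
  aeval fun i => ∑ v, C (F.P i v) * X v

/-- The component of the Jordan matrix, written in the variables of `A`. -/
def component (F : JordanForm A) (c : F.data.Comp) : Ideal (MvPolynomial ι K) :=
  (F.data.component c).comap F.changeOfVars

end JordanForm

end Eigenscheme

end

open MvPolynomial

noncomputable section

namespace Eigenscheme

/-! Send the variable at position `c` of block `b` to `y_b ε ^ c`. On the image a Jordan block with
eigenvalue `λ` acts as multiplication by `λ + ε`, as long as `ε ^ r` is zero for the block size `r`;
hence the columns of `(J x | x)` become proportional. For `T` the blocks of one eigenvalue of size
at least `r_j`, the component `Q_{i,j}` turns out to be the kernel of the map to `K[y_b, ε] / (ε ^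
r_j)` that also kills the blocks outside `T` (`component_eq_kerIdeal`). Primariness, radicals and
Hilbert functions are read off from this kernel: `(ε ^ r_j)` is primary with radical `(ε)`, and in
degree `t ≥ 1` the image has as basis the monomials of degree `t` in the `y_b`, `b ∈ T`, times `1,
ε, …, ε ^ (r_j - 1)`.

The converse inclusions rest on a normal form. For equal eigenvalues the minors are the shift
relations `z_b(c+1) z_b'(d) = z_b(c) z_b'(d+1)`; for different eigenvalues they force every product
`z_b(c) z_b'(d)` into the ideal (`z_mul_z_mem`). Modulo the shift relations a monomial depends only
on its exponent under the parametrization, and it vanishes once the power of `ε` reaches the size of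
one of its blocks. Membership can thus be tested one exponent at a time
(`mem_of_forall_monomial_mem`), which also gives the intersection formula `eigenIdeal_eq_iInf`.

For the reconstruction, radicals are comparable exactly within one eigenvalue, and the Hilbert
function in degrees 1 and 2 yields `r_j` and `k_1 + … + k_j`. The order of the components is then
forced by `r` being decreasing. -/

/-- An indexing of the variables `V` by blocks `b : B` of sizes `r b`. -/
structure BlockFrame (V B : Type*) where
  r : B → ℕ
  equiv : V ≃ Σ b : B, Fin (r b)

/-! ### The monomial parametrization and its kernels -/

namespace BlockFrame

variable {V B : Type*} (E : BlockFrame V B)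

/-- The block of a variable. -/
def blk (v : V) : B := (E.equiv v).1

/-- The position of a variable inside its block. -/
def pos (v : V) : ℕ := (E.equiv v).2

/-- The variable at position `c` of block `b`, or zero if there is none. -/
def z (K : Type*) [Field K] (b : B) (c : ℕ) : MvPolynomial V K :=
  if h : c < E.r b then X (E.equiv.symm ⟨b, ⟨c, h⟩⟩) else 0

lemma pos_lt (v : V) : E.pos v < E.r (E.blk v) := (E.equiv v).2.2

lemma exists_var {b : B} {c : ℕ} (h : c < E.r b) : ∃ v, E.blk v = b ∧ E.pos v = c :=
  ⟨E.equiv.symm ⟨b, ⟨c, h⟩⟩, by simp [blk], by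
    rw [pos, Equiv.apply_symm_apply]⟩

variable {K : Type*} [Field K]

@[simp]
lemma z_blk_pos (v : V) : E.z K (E.blk v) (E.pos v) = X v := by
  rw [z, dif_pos (E.pos_lt v)]
  congr 1
  rw [Equiv.symm_apply_eq]
  rfl

lemma z_of_le {b : B} {c : ℕ} (h : E.r b ≤ c) : E.z K b c = 0 := dif_neg (by omega)

/-- The exponent of the image of a variable in the monomial parametrization. -/
def weight (v : V) : Option B →₀ ℕ :=
  Finsupp.single (some (E.blk v)) 1 + Finsupp.single none (E.pos v)

@[simp]
lemma weight_none (v : V) : E.weight v none = E.pos v := by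
  simp [weight]

lemma weight_some_self (v : V) : E.weight v (some (E.blk v)) = 1 := by
  simp [weight]

lemma weight_some_of_ne {v : V} {b : B} (h : E.blk v ≠ b) : E.weight v (some b) = 0 := by
  simp [weight, h]

/-- The exponent of the image of a monomial. -/
def expo : (V →₀ ℕ) →+ (Option B →₀ ℕ) :=
  Finsupp.liftAddHom fun v => multiplesHom _ (E.weight v)

@[simp]
lemma expo_single (v : V) : E.expo (Finsupp.single v 1) = E.weight v := by
  simp [expo]

variable (K) in
/-- The monomial parametrization `x_v ↦ y_{blk v} ε ^ {pos v}`, where `ε` is the variable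
`none`. -/
def param : MvPolynomial V K →ₐ[K] MvPolynomial (Option B) K :=
  aeval fun v => monomial (E.weight v) 1

@[simp]
lemma param_X (v : V) : E.param K (X v) = monomial (E.weight v) 1 := by
  simp [param]

lemma param_monomial (μ : V →₀ ℕ) (a : K) :
    E.param K (monomial μ a) = monomial (E.expo μ) a := by
  suffices h : E.param K (monomial μ 1) = monomial (E.expo μ) 1 by
    rw [← mul_one a, ← smul_eq_mul, ← smul_monomial, map_smul, h, smul_monomial]
  induction μ using Finsupp.induction_linear with
  | zero => simp
  | add f g hf hg =>
    rw [← one_mul (1 : K), ← monomial_mul, map_mul, hf, hg, monomial_mul, map_add]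
  | single v n =>
    have h1 : (monomial (Finsupp.single v n) (1 : K)) = X v ^ n := by
      rw [X_pow_eq_monomial]
    rw [h1, map_pow, param_X, monomial_pow, one_pow, ← expo_single, ← map_nsmul]
    simp

open Classical in
variable (K) in
/-- The monomial parametrization with the blocks outside `T` sent to zero. -/
def paramOn (T : Set B) : MvPolynomial V K →ₐ[K] MvPolynomial (Option B) K :=
  aeval fun v => if E.blk v ∈ T then monomial (E.weight v) 1 else 0

/-- The exponents that only involve the blocks in `T`. -/
def SupportedOn (T : Set B) (ν : Option B →₀ ℕ) : Prop := ∀ b, ν (some b) ≠ 0 → b ∈ T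

open Classical in
-- Killing blocks only erases those exponents that involve them. All the kernels for varying `T` are
-- thereby conditions on the single polynomial `param f`, so that they can be intersected.
lemma coeff_paramOn (T : Set B) (f : MvPolynomial V K) (ν : Option B →₀ ℕ) :
    coeff ν (E.paramOn K T f) = if SupportedOn T ν then coeff ν (E.param K f) else 0 := by
  induction f using MvPolynomial.induction_on generalizing ν with
  | C a =>
    simp only [← algebraMap_eq, AlgHom.commutes]
    simp only [algebraMap_eq, coeff_C]
    split_ifs with h1 h2 h2 <;> try rfl
    exact absurd (by subst h1; intro b hb; simp at hb) h2
  | add p q hp hq =>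
    simp only [map_add, coeff_add, hp, hq]
    split_ifs <;> simp
  | mul_X p v hp =>
    rw [map_mul, map_mul, param_X, coeff_mul_monomial']
    by_cases hv : E.blk v ∈ T
    · have : E.paramOn K T (X v) = monomial (E.weight v) 1 := by simp [paramOn, hv]
      rw [this, coeff_mul_monomial', hp]
      by_cases hw : E.weight v ≤ ν
      · have hiff : SupportedOn T (ν - E.weight v) ↔ SupportedOn T ν := by
          constructor
          · intro h b hb
            by_cases hbv : E.blk v = b
            · exact hbv ▸ hv
            · apply h b
              rw [Finsupp.tsub_apply, E.weight_some_of_ne hbv]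
              simpa using hb
          · intro h b hb
            apply h b
            rw [Finsupp.tsub_apply] at hb
            omega
        simp [hw, hiff]
      · simp [hw]
    · have : E.paramOn K T (X v) = 0 := by simp [paramOn, hv]
      rw [this, mul_zero, coeff_zero]
      split_ifs with h1 h2
      · refine absurd (h1 (E.blk v) ?_) hv
        have := h2 (some (E.blk v))
        rw [weight_some_self] at this
        omega
      · rfl
      · rfl

variable (K) in
/-- The kernel of the monomial parametrization, with the blocks outside `T` sent to zero,
modulo `ε ^ ρ`. -/
def kerIdeal (T : Set B) (ρ : ℕ) : Ideal (MvPolynomial V K) :=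
  (Ideal.span {(X none : MvPolynomial (Option B) K) ^ ρ}).comap (E.paramOn K T)

lemma X_pow_dvd_iff_coeff {σ : Type*} (i : σ) (ρ : ℕ) (f : MvPolynomial σ K) :
    X i ^ ρ ∣ f ↔ ∀ ν : σ →₀ ℕ, ν i < ρ → coeff ν f = 0 := by
  have h := @mem_ideal_span_monomial_image σ K _ f {Finsupp.single i ρ}
  rw [Set.image_singleton, Ideal.mem_span_singleton, ← X_pow_eq_monomial] at h
  rw [h]
  simp only [mem_support_iff, Set.mem_singleton_iff, exists_eq_left, Finsupp.single_le_iff]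
  exact forall_congr' fun ν => ⟨fun h hν => by_contra fun h' => absurd (h h') (by omega),
    fun h h' => by_contra fun hν => h' (h (by omega))⟩

lemma mem_kerIdeal {T : Set B} {ρ : ℕ} {f : MvPolynomial V K} :
    f ∈ E.kerIdeal K T ρ ↔
      ∀ ν, SupportedOn T ν → ν none < ρ → coeff ν (E.param K f) = 0 := by
  classical
  rw [kerIdeal, Ideal.mem_comap, Ideal.mem_span_singleton, X_pow_dvd_iff_coeff]
  refine forall_congr' fun ν => ?_
  rw [show coeff ν ((E.paramOn K T) f) = _ from E.coeff_paramOn T f ν]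
  by_cases h : SupportedOn T ν <;> simp [h]

lemma X_mem_kerIdeal {T : Set B} {ρ : ℕ} {v : V} :
    X v ∈ E.kerIdeal K T ρ ↔ (E.blk v ∈ T → ρ ≤ E.pos v) := by
  classical
  rw [mem_kerIdeal]
  simp only [param_X, coeff_monomial]
  constructor
  · intro h hv
    by_contra hlt
    have := h (E.weight v) (fun b hb => by
      by_contra hbT
      exact hb (E.weight_some_of_ne fun hvb => hbT (hvb ▸ hv))) (by simpa using hlt)
    simp at this
  · intro h ν hT hν
    rw [if_neg]
    rintro rfl
    have := h (hT _ (by simp [weight_some_self]))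
    simp at hν
    omega

/-- A power of the prime element `ε` generates a primary ideal, and primary ideals contract to
primary ideals. -/
lemma kerIdeal_isPrimary (T : Set B) {ρ : ℕ} (hρ : 0 < ρ) : (E.kerIdeal K T ρ).IsPrimary := by
  have hX : Prime (X none : MvPolynomial (Option B) K) := X_prime
  refine Ideal.IsPrimary.comap ?_ (E.paramOn K T).toRingHom
  rw [Ideal.isPrimary_iff]
  constructor
  · rw [Ne, Ideal.span_singleton_eq_top]
    exact fun h => hX.not_isUnit ((isUnit_pow_iff hρ.ne').1 h)
  · intro x y hxy
    rw [Ideal.mem_span_singleton] at hxy ⊢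
    by_cases hy : X none ∣ y
    · right
      exact ⟨ρ, Ideal.mem_span_singleton.2 (pow_dvd_pow_of_dvd hy ρ)⟩
    · exact Or.inl (hX.pow_dvd_of_dvd_mul_right ρ hy hxy)

lemma radical_kerIdeal (T : Set B) {ρ : ℕ} (hρ : 0 < ρ) :
    (E.kerIdeal K T ρ).radical = E.kerIdeal K T 1 := by
  have hX : Prime (X none : MvPolynomial (Option B) K) := X_prime
  have : (Ideal.span {(X none : MvPolynomial (Option B) K)}).IsPrime :=
    (Ideal.span_singleton_prime hX.ne_zero).2 hX
  unfold kerIdeal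
  rw [pow_one, ← Ideal.span_singleton_pow, ← Ideal.comap_radical, Ideal.radical_pow _ hρ.ne',
    this.radical]

/-- Modulo `ε` exactly the variables at position `0` of the blocks in `T` survive, so the first
variable of a block detects whether the block lies in `T`. -/
lemma kerIdeal_one_le_iff (hr : ∀ b, 0 < E.r b) {T T' : Set B} :
    E.kerIdeal K T 1 ≤ E.kerIdeal K T' 1 ↔ T' ⊆ T := by
  constructor
  · intro h b hb
    by_contra hbT
    obtain ⟨v, rfl, hv⟩ := E.exists_var (hr b)
    have := E.X_mem_kerIdeal.1 (h (E.X_mem_kerIdeal.2 fun h => absurd h hbT)) hb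
    omega
  · intro h f hf
    rw [mem_kerIdeal] at hf ⊢
    exact fun ν hν => hf ν fun b hb => h (hν b hb)

lemma one_notMem_kerIdeal (T : Set B) {ρ : ℕ} (hρ : 0 < ρ) :
    (1 : MvPolynomial V K) ∉ E.kerIdeal K T ρ := by
  rw [mem_kerIdeal]
  intro h
  have := h 0 (by intro b hb; simp at hb) (by simpa using hρ)
  simp at this

/-! ### Compatibility with the standard grading -/

section Degree

variable [Fintype B]

/-- The degree of an exponent in the block variables. -/
def blockDegree : (Option B →₀ ℕ) →+ ℕ where
  toFun ν := ∑ b, ν (some b)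
  map_zero' := by simp
  map_add' := by simp [Finset.sum_add_distrib]

lemma blockDegree_apply (ν : Option B →₀ ℕ) : blockDegree ν = ∑ b, ν (some b) := rfl

lemma blockDegree_weight (v : V) : blockDegree (E.weight v) = 1 := by
  classical
  simp [blockDegree_apply, weight, Finsupp.single_apply]

lemma blockDegree_expo (μ : V →₀ ℕ) : blockDegree (E.expo μ) = μ.degree := by
  induction μ using Finsupp.induction_linear with
  | zero => simp
  | add f g hf hg => simp [hf, hg]
  | single v n =>
    have : Finsupp.single v n = n • Finsupp.single v 1 := by simp
    rw [this, map_nsmul, expo_single, map_nsmul, blockDegree_weight]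
    simp

/-- Every variable has block degree one, so the parametrization is graded when `ε` gets degree zero.
-/
lemma coeff_param_homogeneousComponent (f : MvPolynomial V K) (t : ℕ) (ν : Option B →₀ ℕ) :
    coeff ν (E.param K (homogeneousComponent t f)) =
      if blockDegree ν = t then coeff ν (E.param K f) else 0 := by
  classical
  induction f using MvPolynomial.induction_on' with
  | monomial μ a =>
    have h : homogeneousComponent t (monomial μ a) = if μ.degree = t then monomial μ a else 0 := by
      ext d
      rw [coeff_homogeneousComponent, coeff_monomial]
      by_cases hd : μ = d
      · subst hd
        split_ifs <;> simp_all
      · split_ifs <;> simp [hd]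
    rw [h, apply_ite (E.param K), map_zero, param_monomial, ← E.blockDegree_expo]
    by_cases hν : E.expo μ = ν
    · subst hν
      split_ifs <;> simp
    · split_ifs <;> simp [hν]
  | add p q hp hq =>
    simp only [map_add, coeff_add, hp, hq]
    split_ifs <;> simp

lemma kerIdeal_isHomogeneous (T : Set B) (ρ : ℕ) : IsHomogeneousIdeal (E.kerIdeal K T ρ) := by
  intro f hf t
  rw [mem_kerIdeal] at hf ⊢
  intro ν h1 h2
  rw [coeff_param_homogeneousComponent, hf ν h1 h2, ite_self]

end Degree

/-! ### Normal forms modulo the shift relations -/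

section NormalForm

variable {A : Type*} [CommRing A]

lemma shift_all {w : B → ℕ → A}
    (hw : ∀ b b' c d, w b (c + 1) * w b' d = w b c * w b' (d + 1)) (b b' : B) (c d : ℕ) :
    w b c * w b' d = w b (c + d) * w b' 0 := by
  induction d generalizing c with
  | zero => rfl
  | succ d ih => rw [← hw, ih, add_right_comm, add_assoc]

lemma exists_blk_of_expo_ne_zero {μ : V →₀ ℕ} {b : B} (h : E.expo μ (some b) ≠ 0) :
    ∃ v, μ v ≠ 0 ∧ E.blk v = b := by
  by_contra hcon
  push Not at hcon
  apply h
  have : E.expo μ = μ.sum fun v n => n • E.weight v := by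
    rw [expo, Finsupp.liftAddHom_apply]
    rfl
  rw [this, Finsupp.sum, Finsupp.finsetSum_apply]
  refine Finset.sum_eq_zero fun v hv => ?_
  rw [Finsupp.smul_apply, E.weight_some_of_ne (hcon v (by simpa using hv)), smul_zero]

variable [Fintype B]

/-- The value of the monomial `∏ b, y_b ^ ν b` under `y_b ↦ w b 0`. -/
def baseProd (w : B → ℕ → A) (ν : Option B →₀ ℕ) : A := ∏ b, w b 0 ^ ν (some b)

lemma baseProd_add (w : B → ℕ → A) (ν ν' : Option B →₀ ℕ) :
    baseProd w (ν + ν') = baseProd w ν * baseProd w ν' := by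
  simp [baseProd, pow_add, Finset.prod_mul_distrib]

lemma baseProd_weight (w : B → ℕ → A) (v : V) : baseProd w (E.weight v) = w (E.blk v) 0 := by
  classical
  rw [baseProd, Finset.prod_eq_single (E.blk v)]
  · rw [weight_some_self, pow_one]
  · intro b _ hb
    rw [E.weight_some_of_ne hb.symm, pow_zero]
  · simp

variable [Algebra K A] {w : B → ℕ → A} (φ : MvPolynomial V K →ₐ[K] A)

/-- The extra factor `w b c` absorbs the positions of all other factors, which slide down to
position `0`. A shift always needs two factors, hence the statement about a product. -/
lemma mul_map_monomial (hw : ∀ b b' c d, w b (c + 1) * w b' d = w b c * w b' (d + 1))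
    (hφ : ∀ v, φ (X v) = w (E.blk v) (E.pos v)) (μ : V →₀ ℕ) (b : B) (c : ℕ) :
    w b c * φ (monomial μ 1) = w b (c + E.expo μ none) * baseProd w (E.expo μ) := by
  induction μ using Finsupp.induction_linear generalizing c with
  | zero => simp [baseProd]
  | add f g hf hg =>
    rw [← one_mul (1 : K), ← monomial_mul, map_mul, ← mul_assoc, hf, mul_right_comm, hg, map_add,
      baseProd_add, Finsupp.add_apply, add_assoc]
    ring
  | single v n =>
    induction n generalizing c with
    | zero => simp [baseProd]
    | succ n ih =>
      rw [Finsupp.single_add, ← one_mul (1 : K), ← monomial_mul, map_mul, ← mul_assoc, ih,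
        mul_right_comm, show (monomial (Finsupp.single v 1) (1 : K)) = X v from rfl, hφ,
        shift_all hw, map_add, baseProd_add, expo_single, baseProd_weight, Finsupp.add_apply,
        weight_none, add_assoc]
      ring

/-- One variable of block `b` is split off from the monomial to serve as the absorbing factor of
`mul_map_monomial`. -/
lemma map_monomial_eq (hw : ∀ b b' c d, w b (c + 1) * w b' d = w b c * w b' (d + 1))
    (hφ : ∀ v, φ (X v) = w (E.blk v) (E.pos v)) {μ : V →₀ ℕ} {b : B}
    (hb : E.expo μ (some b) ≠ 0) :
    φ (monomial μ 1) =
      w b (E.expo μ none) * baseProd w (E.expo μ - Finsupp.single (some b) 1) := by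
  obtain ⟨v, hv, rfl⟩ := E.exists_blk_of_expo_ne_zero hb
  obtain ⟨μ', rfl⟩ : ∃ μ', μ = Finsupp.single v 1 + μ' :=
    ⟨μ - Finsupp.single v 1, (add_tsub_cancel_of_le
      (Finsupp.single_le_iff.2 (Nat.one_le_iff_ne_zero.2 hv))).symm⟩
  rw [monomial_single_add, pow_one, map_mul, hφ, E.mul_map_monomial φ hw hφ, map_add, expo_single,
    Finsupp.add_apply, weight_none]
  congr 1
  refine Finset.prod_congr rfl fun b _ => ?_
  congr 1
  classical
  simp [weight]

lemma eq_zero_of_expo_eq_zero {μ : V →₀ ℕ} (h : ∀ b, E.expo μ (some b) = 0) : μ = 0 := by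
  rw [← Finsupp.degree_eq_zero_iff, ← E.blockDegree_expo, blockDegree_apply]
  exact Finset.sum_eq_zero fun b _ => h b

lemma map_monomial_congr (hw : ∀ b b' c d, w b (c + 1) * w b' d = w b c * w b' (d + 1))
    (hφ : ∀ v, φ (X v) = w (E.blk v) (E.pos v)) {μ μ' : V →₀ ℕ} (h : E.expo μ = E.expo μ') :
    φ (monomial μ 1) = φ (monomial μ' 1) := by
  by_cases hb : ∃ b, E.expo μ (some b) ≠ 0
  · obtain ⟨b, hb⟩ := hb
    rw [E.map_monomial_eq φ hw hφ hb, E.map_monomial_eq φ hw hφ (h ▸ hb), h]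
  · push Not at hb
    rw [E.eq_zero_of_expo_eq_zero hb, E.eq_zero_of_expo_eq_zero (μ := μ') (by simpa [← h] using hb)]

/-- If `I` contains the shift relations, then `f` lies in `I` as soon as all monomials whose image
occurs in the image of `f` under the monomial parametrization do. -/
theorem mem_of_forall_monomial_mem {I : Ideal (MvPolynomial V K)}
    (hI : ∀ b b' c d, E.z K b (c + 1) * E.z K b' d - E.z K b c * E.z K b' (d + 1) ∈ I)
    {f : MvPolynomial V K}
    (hf : ∀ μ, coeff (E.expo μ) (E.param K f) ≠ 0 → monomial μ 1 ∈ I) : f ∈ I := by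
  classical
  let φ := Ideal.Quotient.mkₐ K I
  have hw : ∀ b b' c d, φ (E.z K b (c + 1)) * φ (E.z K b' d) =
      φ (E.z K b c) * φ (E.z K b' (d + 1)) := fun b b' c d => by
    rw [← map_mul, ← map_mul]
    exact Ideal.Quotient.eq.2 (hI b b' c d)
  have hφ : ∀ v, φ (X v) = φ (E.z K (E.blk v) (E.pos v)) := fun v => by rw [z_blk_pos]
  -- The quotient map factors through the parametrization: by `map_monomial_congr` its value on a
  -- monomial depends only on the exponent. Exponents that are not attained get the value zero.
  let S : (Option B →₀ ℕ) → MvPolynomial V K ⧸ I := fun ν =>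
    if h : ∃ μ, E.expo μ = ν then φ (monomial h.choose 1) else 0
  have hS : ∀ μ, S (E.expo μ) = φ (monomial μ 1) := fun μ => by
    have h : ∃ μ', E.expo μ' = E.expo μ := ⟨μ, rfl⟩
    simp only [S, dif_pos h]
    exact E.map_monomial_congr (w := fun b c => φ (E.z K b c)) φ hw hφ h.choose_spec
  let s : MvPolynomial (Option B) K →ₗ[K] MvPolynomial V K ⧸ I :=
    (basisMonomials (Option B) K).constr K S
  have hs : ∀ ν, s (monomial ν 1) = S ν := fun ν => by
    have := (basisMonomials (Option B) K).constr_basis K S ν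
    rwa [coe_basisMonomials] at this
  have hs' : ∀ ν a, s (monomial ν a) = a • S ν := fun ν a => by
    rw [← mul_one a, ← smul_eq_mul, ← smul_monomial, map_smul, hs, smul_eq_mul, mul_one]
  have hsφ : ∀ g, s (E.param K g) = φ g := fun g => by
    induction g using MvPolynomial.induction_on' with
    | monomial μ a =>
      rw [param_monomial, hs', hS, ← map_smul, smul_monomial, smul_eq_mul, mul_one]
    | add p q hp hq => rw [map_add, map_add, map_add, hp, hq]
  have h0 : φ f = 0 := by
    rw [← hsφ, (E.param K f).as_sum, map_sum]
    refine Finset.sum_eq_zero fun ν hν => ?_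
    rw [hs']
    by_cases h : ∃ μ, E.expo μ = ν
    · obtain ⟨μ, rfl⟩ := h
      rw [hS, show φ (monomial μ 1) = 0 from
        Ideal.Quotient.eq_zero_iff_mem.2 (hf μ (mem_support_iff.1 hν)), smul_zero]
    · simp only [S, dif_neg h, smul_zero]
  exact Ideal.Quotient.eq_zero_iff_mem.1 h0

lemma monomial_mem_of_X_mem {σ : Type*} {I : Ideal (MvPolynomial σ K)} {μ : σ →₀ ℕ} {v : σ}
    (hv : μ v ≠ 0) (h : X v ∈ I) : monomial μ 1 ∈ I := by
  refine I.mem_of_dvd ?_ h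
  rw [X, monomial_one_dvd_monomial_one, Finsupp.single_le_iff]
  omega

lemma monomial_mem_of_z_mem {I : Ideal (MvPolynomial V K)}
    (hI : ∀ b b' c d, E.z K b (c + 1) * E.z K b' d - E.z K b c * E.z K b' (d + 1) ∈ I)
    {μ : V →₀ ℕ} {b : B} (hb : E.expo μ (some b) ≠ 0) (hz : E.z K b (E.expo μ none) ∈ I) :
    monomial μ 1 ∈ I := by
  let φ := Ideal.Quotient.mkₐ K I
  have hw : ∀ b b' c d, φ (E.z K b (c + 1)) * φ (E.z K b' d) =
      φ (E.z K b c) * φ (E.z K b' (d + 1)) := fun b b' c d => by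
    rw [← map_mul, ← map_mul]
    exact Ideal.Quotient.eq.2 (hI b b' c d)
  have hφ : ∀ v, φ (X v) = φ (E.z K (E.blk v) (E.pos v)) := fun v => by rw [z_blk_pos]
  have := E.map_monomial_eq (w := fun b c => φ (E.z K b c)) φ hw hφ hb
  rw [show φ (E.z K b (E.expo μ none)) = 0 from Ideal.Quotient.eq_zero_iff_mem.2 hz,
    zero_mul] at this
  exact Ideal.Quotient.eq_zero_iff_mem.1 this

/-- An exponent that occurs in `param f` either involves a block outside `T`, so that a variable of
the monomial lies in `I`, or has `ε`-degree at least `ρ`. In the latter case all positions are moved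
into one variable, which lies in `I` or is zero beyond the end of its block. -/
theorem kerIdeal_le {I : Ideal (MvPolynomial V K)} {T : Set B} {ρ : ℕ} (hρ : 0 < ρ)
    (hI : ∀ b b' c d, E.z K b (c + 1) * E.z K b' d - E.z K b c * E.z K b' (d + 1) ∈ I)
    (hX : ∀ v, (E.blk v ∈ T → ρ ≤ E.pos v) → X v ∈ I) : E.kerIdeal K T ρ ≤ I := by
  intro f hf
  rw [mem_kerIdeal] at hf
  refine E.mem_of_forall_monomial_mem hI fun μ hμ => ?_
  by_cases hT : SupportedOn T (E.expo μ)
  · have hle : ρ ≤ E.expo μ none := by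
      by_contra h
      exact hμ (hf _ hT (by omega))
    -- The constant monomial has `ε`-degree `0 < ρ`, so some block occurs.
    obtain ⟨b, hb⟩ : ∃ b, E.expo μ (some b) ≠ 0 := by
      by_contra! h
      rw [E.eq_zero_of_expo_eq_zero h] at hle
      simp at hle
      omega
    refine E.monomial_mem_of_z_mem hI hb ?_
    by_cases hlt : E.expo μ none < E.r b
    · obtain ⟨v, hv, hv'⟩ := E.exists_var hlt
      rw [← hv, ← hv', z_blk_pos]
      exact hX v fun _ => hv' ▸ hle
    · rw [E.z_of_le (by omega)]
      exact I.zero_mem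
  · simp only [SupportedOn, not_forall] at hT
    obtain ⟨b, hb, hbT⟩ := hT
    obtain ⟨v, hv, rfl⟩ := E.exists_blk_of_expo_ne_zero hb
    exact monomial_mem_of_X_mem hv (hX v fun h => absurd h hbT)

end NormalForm

end BlockFrame

/-! ### Minors and shift relations of Jordan matrices -/

lemma augmented_minor {K ι : Type*} [Field K] [Fintype ι] (A : Matrix ι ι K) (p q : ι) :
    ((augmented A).submatrix ![p, q] id).det =
      (∑ j, C (A p j) * X j) * X q - X p * ∑ j, C (A q j) * X j := by
  rw [Matrix.det_fin_two]
  simp [augmented]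

lemma minor_mem_eigenIdeal {K ι : Type*} [Field K] [Fintype ι] (A : Matrix ι ι K) (p q : ι) :
    (∑ j, C (A p j) * X j) * X q - X p * ∑ j, C (A q j) * X j ∈ eigenIdeal A := by
  rw [← augmented_minor]
  exact Ideal.subset_span ⟨(p, q), rfl⟩

lemma eigenIdeal_le_iff {K ι : Type*} [Field K] [Fintype ι] {A : Matrix ι ι K}
    {I : Ideal (MvPolynomial ι K)} :
    eigenIdeal A ≤ I ↔
      ∀ p q, (∑ j, C (A p j) * X j) * X q - X p * ∑ j, C (A q j) * X j ∈ I := by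
  refine ⟨fun h p q => h (minor_mem_eigenIdeal A p q), fun h => ?_⟩
  rw [eigenIdeal, Ideal.span_le]
  rintro _ ⟨⟨p, q⟩, rfl⟩
  change ((augmented A).submatrix ![p, q] id).det ∈ I
  rw [augmented_minor]
  exact h p q

namespace BlockFrame

variable {V B : Type*} (E : BlockFrame V B) {K : Type*} [Field K]

lemma monomial_weight (v : V) : (monomial (E.weight v) (1 : K)) =
    X (some (E.blk v)) * X none ^ E.pos v := by
  rw [X_pow_eq_monomial, X, monomial_mul, one_mul, weight]

lemma paramOn_X_of_mem {T : Set B} {v : V} (h : E.blk v ∈ T) :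
    E.paramOn K T (X v) = X (some (E.blk v)) * X none ^ E.pos v := by
  rw [← monomial_weight]
  simp [paramOn, h]

lemma paramOn_X_of_notMem {T : Set B} {v : V} (h : E.blk v ∉ T) : E.paramOn K T (X v) = 0 := by
  simp [paramOn, h]

lemma paramOn_z_of_notMem {T : Set B} {b : B} (h : b ∉ T) (c : ℕ) :
    E.paramOn K T (E.z K b c) = 0 := by
  by_cases hc : c < E.r b
  · obtain ⟨v, rfl, rfl⟩ := E.exists_var hc
    rw [z_blk_pos, E.paramOn_X_of_notMem h]
  · rw [E.z_of_le (by omega), map_zero]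

/-- Moving to the next position is multiplication by `ε`. At the end of a block the next variable is
zero, while the power of `ε` has reached the block size, which is at least `ρ`. -/
lemma paramOn_z_succ {T : Set B} {v : V} (h : E.blk v ∈ T) {ρ : ℕ} (hρ : ρ ≤ E.r (E.blk v)) :
    (X none : MvPolynomial (Option B) K) ^ ρ ∣
      E.paramOn K T (E.z K (E.blk v) (E.pos v + 1)) - X none * E.paramOn K T (X v) := by
  rw [E.paramOn_X_of_mem h]
  by_cases hc : E.pos v + 1 < E.r (E.blk v)
  · obtain ⟨u, hu, hu'⟩ := E.exists_var hc
    rw [← hu', ← hu, z_blk_pos, E.paramOn_X_of_mem (hu ▸ h), hu', hu, pow_succ]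
    convert dvd_zero _
    ring
  · rw [E.z_of_le (by omega), map_zero, zero_sub, dvd_neg, mul_left_comm, ← pow_succ']
    exact Dvd.dvd.mul_left (pow_dvd_pow _ (by omega)) _

variable [Fintype V]

/-- `M` is a Jordan matrix with respect to the block frame `E`, with eigenvalues `lam`. -/
def IsJordan (lam : B → K) (M : Matrix V V K) : Prop :=
  ∀ v, ∑ u, C (M v u) * X u =
    C (lam (E.blk v)) * X v + E.z K (E.blk v) (E.pos v + 1)

variable {E} {lam : B → K} {M : Matrix V V K}

/-- This is the minor of the rows `(b, c)` and `(b', d)`. Beyond the end of a block every term has a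
zero factor, so no bounds on `c` and `d` are needed. -/
lemma IsJordan.minor_mem (hM : E.IsJordan lam M) (b b' : B) (c d : ℕ) :
    C (lam b - lam b') * (E.z K b c * E.z K b' d) +
      (E.z K b (c + 1) * E.z K b' d - E.z K b c * E.z K b' (d + 1)) ∈ eigenIdeal M := by
  by_cases hc : c < E.r b
  · by_cases hd : d < E.r b'
    · obtain ⟨u, rfl, rfl⟩ := E.exists_var hc
      obtain ⟨v, rfl, rfl⟩ := E.exists_var hd
      have := minor_mem_eigenIdeal M u v
      rw [hM u, hM v] at this
      convert this using 1
      simp only [z_blk_pos, map_sub]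
      ring
    · rw [E.z_of_le (b := b') (c := d) (by omega), E.z_of_le (b := b') (c := d + 1) (by omega)]
      simp
  · rw [E.z_of_le (b := b) (c := c) (by omega), E.z_of_le (b := b) (c := c + 1) (by omega)]
    simp

/-- The minor expresses `(λ - λ') z_b(c) z_b'(d)` through products with larger `c + d`, and these
products vanish once `c + d ≥ r b + r b'`. The induction descends on `c + d`. -/
lemma IsJordan.z_mul_z_mem (hM : E.IsJordan lam M) {b b' : B} (h : lam b ≠ lam b') (c d : ℕ) :
    E.z K b c * E.z K b' d ∈ eigenIdeal M := by
  suffices H : ∀ n c d, E.r b + E.r b' ≤ c + d + n → E.z K b c * E.z K b' d ∈ eigenIdeal M from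
    H (E.r b + E.r b') c d (by omega)
  intro n
  induction n with
  | zero =>
    intro c d hcd
    by_cases hc : E.r b ≤ c
    · rw [E.z_of_le hc, zero_mul]
      exact Ideal.zero_mem _
    · rw [E.z_of_le (b := b') (c := d) (by omega), mul_zero]
      exact Ideal.zero_mem _
  | succ n ih =>
    intro c d hcd
    have h1 := ih (c + 1) d (by omega)
    have h2 := ih c (d + 1) (by omega)
    have h3 := (Ideal.add_mem_iff_left _ (Ideal.sub_mem _ h1 h2)).1 (hM.minor_mem b b' c d)
    have h4 := Ideal.mul_mem_left _ (C (lam b - lam b')⁻¹) h3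
    rwa [← mul_assoc, ← map_mul, inv_mul_cancel₀ (sub_ne_zero.2 h), map_one, one_mul] at h4

lemma IsJordan.shift_mem (hM : E.IsJordan lam M) (b b' : B) (c d : ℕ) :
    E.z K b (c + 1) * E.z K b' d - E.z K b c * E.z K b' (d + 1) ∈ eigenIdeal M := by
  by_cases h : lam b = lam b'
  · simpa [h] using hM.minor_mem b b' c d
  · exact Ideal.sub_mem _ (hM.z_mul_z_mem h _ _) (hM.z_mul_z_mem h _ _)

/-- With a common eigenvalue on `T`, the first column becomes `λ + ε` times the second modulo `ε ^
ρ`, so the minors vanish there. -/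
lemma IsJordan.eigenIdeal_le_kerIdeal (hM : E.IsJordan lam M) {T : Set B} {ρ : ℕ}
    (hT : ∀ b ∈ T, ∀ b' ∈ T, lam b = lam b') (hρ : ∀ b ∈ T, ρ ≤ E.r b) :
    eigenIdeal M ≤ E.kerIdeal K T ρ := by
  rw [eigenIdeal_le_iff]
  intro u v
  rw [hM u, hM v, kerIdeal, Ideal.mem_comap, Ideal.mem_span_singleton]
  change _ ∣ E.paramOn K T _
  simp only [map_sub, map_mul, map_add]
  by_cases hu : E.blk u ∈ T
  · by_cases hv : E.blk v ∈ T
    · obtain ⟨g, hg⟩ := E.paramOn_z_succ (K := K) hu (hρ _ hu)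
      obtain ⟨g', hg'⟩ := E.paramOn_z_succ (K := K) hv (hρ _ hv)
      rw [hT _ hu _ hv, sub_eq_iff_eq_add.1 hg, sub_eq_iff_eq_add.1 hg']
      exact ⟨g * E.paramOn K T (X v) - g' * E.paramOn K T (X u), by ring⟩
    · rw [E.paramOn_z_of_notMem hv, E.paramOn_X_of_notMem hv]
      simp
  · rw [E.paramOn_z_of_notMem hu, E.paramOn_X_of_notMem hu]
    simp

end BlockFrame

lemma sum_jordanBlock {K A : Type*} [Field K] [CommRing A] [Algebra K A] (lam : K) {m : ℕ}
    (c : Fin m) (f : Fin m → A) :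
    ∑ d, algebraMap K A (jordanBlock lam m c d) * f d =
      algebraMap K A lam * f c + if h : (c : ℕ) + 1 < m then f ⟨c + 1, h⟩ else 0 := by
  have h1 : ∀ d, algebraMap K A (jordanBlock lam m c d) * f d =
      (if c = d then algebraMap K A lam * f d else 0) +
        if (c : ℕ) + 1 = d then f d else 0 := by
    intro d
    simp only [jordanBlock, Matrix.of_apply]
    by_cases hcd : c = d
    · subst hcd
      simp
    · by_cases h : (c : ℕ) + 1 = d <;> simp [hcd, h]
  simp only [h1, Finset.sum_add_distrib, Finset.sum_ite_eq, Finset.mem_univ, if_true]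
  congr 1
  split_ifs with h
  · rw [Finset.sum_eq_single ⟨c + 1, h⟩]
    · simp
    · intro d _ hd
      rw [if_neg]
      exact fun h' => hd (Fin.ext h'.symm)
    · simp
  · refine Finset.sum_eq_zero fun d _ => if_neg fun h' => ?_
    omega

/-! ### A single eigenvalue -/

namespace BlockType

variable {K : Type*} [Field K] (S : BlockType)

/-- The block frame of the variables of a single eigenvalue. -/
def frame : BlockFrame S.Index S.Block where
  r b := S.r b.1
  equiv := Equiv.refl _

lemma isJordan (lam : K) : S.frame.IsJordan (fun _ => lam) (S.matrix lam) := by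
  rintro ⟨b, c⟩
  rw [Fintype.sum_sigma, Finset.sum_eq_single b]
  · simp only [matrix, Matrix.blockDiagonal'_apply_eq]
    exact sum_jordanBlock (A := MvPolynomial S.Index K) lam c fun d => X ⟨b, d⟩
  · intro b' _ hb
    refine Finset.sum_eq_zero fun d _ => ?_
    rw [matrix, Matrix.blockDiagonal'_apply_ne _ _ _ hb.symm, map_zero, zero_mul]
  · simp

/-- The blocks of size at least `r j`. -/
def headBlocks (j : Fin S.len) : Set S.Block := {b | b.1 ≤ j}

theorem q_eq_kerIdeal (lam : K) (j : Fin S.len) :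
    S.q K lam j = S.frame.kerIdeal K (S.headBlocks j) (S.r j) := by
  apply le_antisymm
  · refine sup_le ((S.isJordan lam).eigenIdeal_le_kerIdeal (fun _ _ _ _ => rfl)
      fun b hb => S.r_anti.antitone hb) (sup_le ?_ ?_)
    · rw [Ideal.span_le]
      rintro _ ⟨v, hv, rfl⟩
      exact S.frame.X_mem_kerIdeal.2 fun _ => hv.2
    · rw [Ideal.span_le]
      rintro _ ⟨v, hv, rfl⟩
      exact S.frame.X_mem_kerIdeal.2 fun h =>
        absurd h (not_le_of_gt (show j < v.1.1 from hv))
  · refine S.frame.kerIdeal_le (S.r_pos j) (fun b b' c d =>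
      (le_sup_left : _ ≤ S.q K lam j) ((S.isJordan lam).shift_mem b b' c d)) fun v hv => ?_
    by_cases h : v.1.1 ≤ j
    · exact (le_sup_of_le_right le_sup_left : _ ≤ S.q K lam j)
        (Ideal.subset_span ⟨v, ⟨h, hv h⟩, rfl⟩)
    · exact (le_sup_of_le_right le_sup_right : _ ≤ S.q K lam j)
        (Ideal.subset_span ⟨v, lt_of_not_ge h, rfl⟩)

end BlockType

/-! ### Several eigenvalues: the primary decomposition -/

namespace JordanData

variable {K : Type*} [Field K] (D : JordanData K)

/-- The block frame of the variables of all eigenvalues. -/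
def frame : BlockFrame D.Index (Σ i : Fin D.n, (D.type i).Block) where
  r b := (D.type b.1).r b.2.1
  equiv := (Equiv.sigmaAssoc fun i (b : (D.type i).Block) => Fin ((D.type i).r b.1)).symm

lemma frame_r_pos (b : Σ i : Fin D.n, (D.type i).Block) : 0 < D.frame.r b :=
  (D.type b.1).r_pos _

variable (K) in
lemma z_frame (i : Fin D.n) (b : (D.type i).Block) (c : ℕ) :
    D.frame.z K ⟨i, b⟩ c =
      rename (fun v => (⟨i, v⟩ : D.Index)) ((D.type i).frame.z K b c) := by
  unfold BlockFrame.z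
  by_cases h : c < (D.type i).r b.1
  · rw [dif_pos (show c < D.frame.r ⟨i, b⟩ from h),
      dif_pos (show c < (D.type i).frame.r b from h), rename_X]
    rfl
  · rw [dif_neg (show ¬ c < D.frame.r ⟨i, b⟩ from h),
      dif_neg (show ¬ c < (D.type i).frame.r b from h), map_zero]

lemma sum_matrix (i : Fin D.n) (v : (D.type i).Index) :
    ∑ u, C (D.matrix ⟨i, v⟩ u) * (X u : MvPolynomial D.Index K) =
      rename (fun v => (⟨i, v⟩ : D.Index))
        (∑ u, C ((D.type i).matrix (D.eigenvalue i) v u) * X u) := by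
  rw [Fintype.sum_sigma, Finset.sum_eq_single i]
  · simp [matrix, Matrix.blockDiagonal'_apply_eq]
  · intro i' _ hi
    refine Finset.sum_eq_zero fun d _ => ?_
    rw [matrix, Matrix.blockDiagonal'_apply_ne _ _ _ hi.symm, map_zero, zero_mul]
  · simp

lemma isJordan : D.frame.IsJordan (fun b => D.eigenvalue b.1) D.matrix := by
  rintro ⟨i, v⟩
  rw [sum_matrix, (D.type i).isJordan (D.eigenvalue i) v, map_add, map_mul, rename_C, rename_X,
    ← z_frame]
  rfl

lemma map_eigenIdeal_le (i : Fin D.n) :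
    (eigenIdeal ((D.type i).matrix (D.eigenvalue i))).map
      (rename (fun v => (⟨i, v⟩ : D.Index)) :
        MvPolynomial (D.type i).Index K →ₐ[K] MvPolynomial D.Index K) ≤ eigenIdeal D.matrix := by
  rw [Ideal.map_le_iff_le_comap, eigenIdeal_le_iff]
  intro p q
  rw [Ideal.mem_comap, map_sub, map_mul, map_mul, ← sum_matrix, ← sum_matrix, rename_X, rename_X]
  exact minor_mem_eigenIdeal D.matrix _ _

/-- The blocks with eigenvalue `c.1` of size class at most `c.2`. -/
def headBlocks (c : D.Comp) : Set (Σ i : Fin D.n, (D.type i).Block) :=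
  Sigma.mk c.1 '' (D.type c.1).headBlocks c.2

lemma mk_mem_headBlocks {i : Fin D.n} {b : (D.type i).Block} {j : Fin (D.type i).len} :
    ⟨i, b⟩ ∈ D.headBlocks ⟨i, j⟩ ↔ b.1 ≤ j := by
  simp [headBlocks, BlockType.headBlocks]

lemma fst_of_mem_headBlocks {c : D.Comp} {b : Σ i : Fin D.n, (D.type i).Block}
    (h : b ∈ D.headBlocks c) : b.1 = c.1 := by
  obtain ⟨b, _, rfl⟩ := h
  rfl

lemma eigenIdeal_le_kerIdeal (c : D.Comp) :
    eigenIdeal D.matrix ≤ D.frame.kerIdeal K (D.headBlocks c) ((D.type c.1).r c.2) := by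
  refine D.isJordan.eigenIdeal_le_kerIdeal (fun b hb b' hb' => ?_) fun b hb => ?_
  · simp only [D.fst_of_mem_headBlocks hb, D.fst_of_mem_headBlocks hb']
  · obtain ⟨b, hb, rfl⟩ := hb
    exact (D.type c.1).r_anti.antitone hb

lemma X_mem_component {c : D.Comp} {v : D.Index} (h : v.1 ≠ c.1) :
    (X v : MvPolynomial D.Index K) ∈ D.component c :=
  (le_sup_right : _ ≤ D.component c) (Ideal.subset_span ⟨v, h, rfl⟩)

lemma rename_mem_component {c : D.Comp} {f : MvPolynomial (D.type c.1).Index K} (h : f ∈ D.q c) :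
    rename (fun v => (⟨c.1, v⟩ : D.Index)) f ∈ D.component c :=
  (le_sup_left : _ ≤ D.component c) (Ideal.mem_map_of_mem _ h)

lemma z_mem_component {c : D.Comp} {b : Σ i : Fin D.n, (D.type i).Block} (h : b.1 ≠ c.1)
    (d : ℕ) : D.frame.z K b d ∈ D.component c := by
  by_cases hd : d < D.frame.r b
  · obtain ⟨v, rfl, rfl⟩ := D.frame.exists_var hd
    rw [BlockFrame.z_blk_pos]
    exact D.X_mem_component h
  · rw [D.frame.z_of_le (by omega)]
    exact Ideal.zero_mem _

/-- Within the eigenvalue of `c` the relation comes from the smaller polynomial ring; otherwise each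
term contains a variable of `𝔭_i` or zero. -/
lemma shift_mem_component (c : D.Comp) (b b' : Σ i : Fin D.n, (D.type i).Block) (d d' : ℕ) :
    D.frame.z K b (d + 1) * D.frame.z K b' d' - D.frame.z K b d * D.frame.z K b' (d' + 1) ∈
      D.component c := by
  by_cases h : b.1 = c.1
  · by_cases h' : b'.1 = c.1
    · obtain ⟨i, j⟩ := c
      obtain ⟨_, b⟩ := b
      obtain ⟨_, b'⟩ := b'
      dsimp only at h h'
      subst h
      subst h'
      simp only [z_frame, ← map_mul, ← map_sub]
      refine D.rename_mem_component (c := ⟨_, j⟩) ((le_sup_left : _ ≤ D.q ⟨_, j⟩) ?_)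
      exact ((D.type _).isJordan _).shift_mem b b' d d'
    · exact Ideal.sub_mem _ (Ideal.mul_mem_left _ _ (D.z_mem_component h' _))
        (Ideal.mul_mem_left _ _ (D.z_mem_component h' _))
  · exact Ideal.sub_mem _ (Ideal.mul_mem_right _ _ (D.z_mem_component h _))
      (Ideal.mul_mem_right _ _ (D.z_mem_component h _))

theorem component_eq_kerIdeal (c : D.Comp) :
    D.component c = D.frame.kerIdeal K (D.headBlocks c) ((D.type c.1).r c.2) := by
  apply le_antisymm
  · refine sup_le ?_ ?_
    · unfold q BlockType.q
      rw [Ideal.map_sup, Ideal.map_sup]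
      refine sup_le ((D.map_eigenIdeal_le c.1).trans (D.eigenIdeal_le_kerIdeal c))
        (sup_le ?_ ?_)
      · rw [Ideal.map_span, Ideal.span_le]
        rintro _ ⟨_, ⟨v, hv, rfl⟩, rfl⟩
        rw [rename_X]
        exact D.frame.X_mem_kerIdeal.2 fun _ => hv.2
      · rw [Ideal.map_span, Ideal.span_le]
        rintro _ ⟨_, ⟨v, hv, rfl⟩, rfl⟩
        rw [rename_X]
        exact D.frame.X_mem_kerIdeal.2 fun h =>
          absurd (D.mk_mem_headBlocks.1 h) (not_le_of_gt hv)
    · rw [p, Ideal.span_le]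
      rintro _ ⟨v, hv, rfl⟩
      exact D.frame.X_mem_kerIdeal.2 fun h => absurd (D.fst_of_mem_headBlocks h) hv
  · refine D.frame.kerIdeal_le ((D.type c.1).r_pos c.2) (D.shift_mem_component c) fun v hv => ?_
    obtain ⟨i, j⟩ := c
    obtain ⟨i', v⟩ := v
    by_cases h : i' = i
    · subst h
      have := D.rename_mem_component (c := ⟨i', j⟩) (f := X v) (by
        rw [q, BlockType.q_eq_kerIdeal]
        exact (D.type i').frame.X_mem_kerIdeal.2 fun h => hv (D.mk_mem_headBlocks.2 h))
      rwa [rename_X] at this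
    · exact D.X_mem_component h

/-- For the hard inclusion, each exponent of `param f` is treated separately: either its monomials
already lie in `I_J`, or one of the components forces its coefficient to vanish. -/
theorem eigenIdeal_eq_iInf : eigenIdeal D.matrix = ⨅ c, D.component c := by
  classical
  apply le_antisymm
  · refine le_iInf fun c => ?_
    rw [component_eq_kerIdeal]
    exact D.eigenIdeal_le_kerIdeal c
  · intro f hf
    have hf' : ∀ c ν, BlockFrame.SupportedOn (D.headBlocks c) ν → ν none < (D.type c.1).r c.2 →
        coeff ν (D.frame.param K f) = 0 := fun c => by
      have := (Ideal.mem_iInf.1 hf) c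
      rwa [component_eq_kerIdeal, BlockFrame.mem_kerIdeal] at this
    refine D.frame.mem_of_forall_monomial_mem D.isJordan.shift_mem fun μ hμ => ?_
    -- A constant term is excluded by any one component, and there is at least one.
    by_cases h0 : ∀ b, D.frame.expo μ (some b) = 0
    · rw [D.frame.eq_zero_of_expo_eq_zero h0, map_zero] at hμ
      refine absurd (hf' ⟨⟨0, D.n_pos⟩, ⟨0, (D.type _).len_pos⟩⟩ 0 (fun b hb => ?_) ?_) hμ
      · simp at hb
      · exact (D.type _).r_pos _
    push Not at h0
    obtain ⟨⟨i, b₀⟩, hb₀⟩ := h0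
    -- Two different eigenvalues occur: the monomial is divisible by a product of two variables that
    -- lies in `I_J`.
    by_cases hi : ∃ b, D.frame.expo μ (some b) ≠ 0 ∧ b.1 ≠ i
    · obtain ⟨b, hb, hbi⟩ := hi
      obtain ⟨u, hu, hu'⟩ := D.frame.exists_blk_of_expo_ne_zero hb
      obtain ⟨v, hv, hv'⟩ := D.frame.exists_blk_of_expo_ne_zero hb₀
      have hmem := D.isJordan.z_mul_z_mem (b := D.frame.blk u) (b' := D.frame.blk v)
        (fun h => hbi (by simpa [hu', hv'] using D.eigenvalue_injective h))
        (D.frame.pos u) (D.frame.pos v)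
      rw [BlockFrame.z_blk_pos, BlockFrame.z_blk_pos] at hmem
      refine Ideal.mem_of_dvd _ ?_ hmem
      have huv : u ≠ v := by
        rintro rfl
        exact hbi (by rw [← hu', hv'])
      rw [X, X, monomial_mul, one_mul, monomial_one_dvd_monomial_one]
      intro w
      simp only [Finsupp.add_apply, Finsupp.single_apply]
      split_ifs with h1 h2 h2
      · exact absurd (h1.trans h2.symm) huv
      · subst h1; omega
      · subst h2; omega
      · simp
    · push Not at hi
      let s : Finset (D.type i).Block :=
        Finset.univ.filter fun b => D.frame.expo μ (some ⟨i, b⟩) ≠ 0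
      -- The largest size class is the smallest block occurring. If the `ε`-degree reaches its size,
      -- the monomial vanishes modulo `I_J`; otherwise the component of this class contains all
      -- occurring blocks and kills the coefficient.
      obtain ⟨b, hb, hmax⟩ := s.exists_max_image (fun b => b.1) ⟨b₀, by simpa [s] using hb₀⟩
      have hb' : D.frame.expo μ (some ⟨i, b⟩) ≠ 0 := by simpa [s] using hb
      refine D.frame.monomial_mem_of_z_mem D.isJordan.shift_mem hb' ?_
      rw [D.frame.z_of_le]
      · exact Ideal.zero_mem _
      by_contra hlt
      refine hμ (hf' ⟨i, b.1⟩ _ (fun b' hb'' => ?_) (not_le.1 hlt))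
      obtain ⟨i', b'⟩ := b'
      obtain rfl : i' = i := hi _ hb''
      exact D.mk_mem_headBlocks.2 (hmax b' (by simpa [s] using hb''))

lemma radical_component (c : D.Comp) :
    (D.component c).radical = D.frame.kerIdeal K (D.headBlocks c) 1 := by
  rw [component_eq_kerIdeal, BlockFrame.radical_kerIdeal _ _ ((D.type c.1).r_pos c.2)]

/-- The first block of a size class. -/
def firstBlock (c : D.Comp) : Σ i : Fin D.n, (D.type i).Block :=
  ⟨c.1, c.2, ⟨0, (D.type c.1).k_pos c.2⟩⟩

lemma firstBlock_mem (c : D.Comp) : D.firstBlock c ∈ D.headBlocks c :=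
  ⟨_, le_refl c.2, rfl⟩

lemma headBlocks_subset_iff {c c' : D.Comp} :
    D.headBlocks c ⊆ D.headBlocks c' ↔ ∃ h : c.1 = c'.1, Fin.cast (by rw [h]) c.2 ≤ c'.2 := by
  obtain ⟨i, j⟩ := c
  obtain ⟨i', j'⟩ := c'
  constructor
  · intro h
    have h1 := h (D.firstBlock_mem ⟨i, j⟩)
    obtain rfl : i = i' := D.fst_of_mem_headBlocks h1
    exact ⟨rfl, D.mk_mem_headBlocks.1 h1⟩
  · rintro ⟨h, hle⟩
    dsimp only at h
    subst h
    rintro _ ⟨b, hb, rfl⟩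
    exact D.mk_mem_headBlocks.2 (le_trans hb hle)

lemma radical_le_iff {c c' : D.Comp} :
    (D.component c).radical ≤ (D.component c').radical ↔ D.headBlocks c' ⊆ D.headBlocks c := by
  rw [radical_component, radical_component, BlockFrame.kerIdeal_one_le_iff _ D.frame_r_pos]

theorem radicalsComparable_iff (c c' : D.Comp) :
    RadicalsComparable (D.component c) (D.component c') ↔ c.1 = c'.1 := by
  rw [RadicalsComparable, radical_le_iff, radical_le_iff]
  constructor
  · rintro (h | h)
    · exact (D.headBlocks_subset_iff.1 h).1.symm
    · exact (D.headBlocks_subset_iff.1 h).1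
  · obtain ⟨i, j⟩ := c
    obtain ⟨i', j'⟩ := c'
    rintro h
    dsimp only at h
    subst h
    rcases le_total j' j with hj | hj
    · exact Or.inl (D.headBlocks_subset_iff.2 ⟨rfl, hj⟩)
    · exact Or.inr (D.headBlocks_subset_iff.2 ⟨rfl, hj⟩)

lemma radical_component_injective : Function.Injective fun c => (D.component c).radical := by
  intro c c' h
  have h1 := D.headBlocks_subset_iff.1 (D.radical_le_iff.1 (le_of_eq h))
  have h2 := D.headBlocks_subset_iff.1 (D.radical_le_iff.1 (ge_of_eq h))
  obtain ⟨i, j⟩ := c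
  obtain ⟨i', j'⟩ := c'
  obtain ⟨h, h1⟩ := h1
  obtain ⟨_, h2⟩ := h2
  dsimp only at h
  subst h
  have : j = j' := le_antisymm h2 h1
  rw [this]

/-- The witness is the last variable, at position `r_j - 1`, of a block of size `r_j`. It lies in
the components with `j' < j` because its block is killed, in those with `j' > j` because `r_j' ≤ r_j
- 1`, and in those of other eigenvalues through `𝔭`. -/
lemma component_irredundant (c : D.Comp) :
    ¬ (⨅ c', ⨅ _ : c' ≠ c, D.component c') ≤ D.component c := by
  intro hle
  obtain ⟨v, hv, hv'⟩ := D.frame.exists_var (b := D.firstBlock c)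
    (c := D.frame.r (D.firstBlock c) - 1) (Nat.sub_lt (D.frame_r_pos _) one_pos)
  have hr : D.frame.r (D.firstBlock c) = (D.type c.1).r c.2 := rfl
  have hpos := (D.type c.1).r_pos c.2
  have hnot : X v ∉ D.component c := by
    rw [component_eq_kerIdeal, BlockFrame.X_mem_kerIdeal, hv, hv']
    intro h
    have := h (D.firstBlock_mem c)
    omega
  refine hnot (hle ?_)
  simp only [Ideal.mem_iInf]
  intro c' hc'
  rw [component_eq_kerIdeal, BlockFrame.X_mem_kerIdeal, hv, hv', hr]
  intro h
  obtain ⟨i, j⟩ := c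
  obtain ⟨i', j'⟩ := c'
  obtain rfl : i = i' := D.fst_of_mem_headBlocks h
  have h1 : j ≤ j' := D.mk_mem_headBlocks.1 h
  have h2 : j < j' := lt_of_le_of_ne h1 (by rintro rfl; exact hc' rfl)
  have := (D.type i).r_anti h2
  dsimp only
  omega

theorem isIrredundantPrimaryDecomposition :
    IsIrredundantPrimaryDecomposition (eigenIdeal D.matrix) D.component where
  eq_iInf := D.eigenIdeal_eq_iInf
  primary c := by
    rw [component_eq_kerIdeal]
    exact D.frame.kerIdeal_isPrimary _ ((D.type c.1).r_pos c.2)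
  irredundant := D.component_irredundant
  radical_injective := D.radical_component_injective

end JordanData

/-! ### Hilbert functions -/

/-- This allows the quotient map to be replaced by any linear map with the same kernel on the forms
of degree `t`. -/
lemma finrank_map_eq_of_forall {K M N N' : Type*} [Field K] [AddCommGroup M] [Module K M]
    [AddCommGroup N] [Module K N] [AddCommGroup N'] [Module K N'] (W : Submodule K M)
    (f : M →ₗ[K] N) (g : M →ₗ[K] N') (h : ∀ x ∈ W, f x = 0 ↔ g x = 0) :
    Module.finrank K (W.map f) = Module.finrank K (W.map g) := by
  have hker : LinearMap.ker (f.domRestrict W) = LinearMap.ker (g.domRestrict W) := by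
    ext ⟨x, hx⟩
    simpa using h x hx
  rw [← LinearMap.range_domRestrict, ← LinearMap.range_domRestrict,
    ← (f.domRestrict W).quotKerEquivRange.finrank_eq,
    ← (g.domRestrict W).quotKerEquivRange.finrank_eq,
    (Submodule.quotEquivOfEq _ _ hker).finrank_eq]

lemma hilbertFunction_eq_finrank_map {K σ N : Type*} [Field K] [AddCommGroup N] [Module K N]
    (I : Ideal (MvPolynomial σ K)) (t : ℕ) (g : MvPolynomial σ K →ₗ[K] N)
    (h : ∀ f : MvPolynomial σ K, f.IsHomogeneous t → (f ∈ I ↔ g f = 0)) :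
    hilbertFunction I t = Module.finrank K ((homogeneousSubmodule σ K t).map g) :=
  finrank_map_eq_of_forall _ _ _ fun f hf => by
    rw [← h f hf]
    exact Ideal.Quotient.eq_zero_iff_mem

lemma hilbertFunction_zero {K σ : Type*} [Field K] {I : Ideal (MvPolynomial σ K)}
    (h : (1 : MvPolynomial σ K) ∉ I) : hilbertFunction I 0 = 1 := by
  have h1 : homogeneousSubmodule σ K 0 = Submodule.span K {1} := by
    rw [homogeneousSubmodule_zero, Submodule.one_eq_span]
  rw [hilbertFunction, h1, Submodule.map_span, Set.image_singleton]
  exact finrank_span_singleton fun h0 => h (Ideal.Quotient.eq_zero_iff_mem.1 h0)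

namespace BlockFrame

variable {V B : Type*} [Fintype B] (E : BlockFrame V B) {K : Type*} [Field K]

lemma exists_expo_eq (hr : ∀ b, 0 < E.r b) {ν : Option B →₀ ℕ} (hν : ν none = 0) :
    ∃ μ, E.expo μ = ν := by
  classical
  choose v hv hv' using fun b => E.exists_var (hr b)
  refine ⟨∑ b, ν (some b) • Finsupp.single (v b) 1, ?_⟩
  rw [map_sum]
  simp only [map_nsmul, expo_single]
  ext o
  rw [Finsupp.finsetSum_apply]
  simp only [Finsupp.smul_apply, smul_eq_mul]
  cases o with
  | none => simp [hv', hν]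
  | some b =>
    rw [Finset.sum_eq_single b]
    · have := E.weight_some_self (v b)
      rw [hv] at this
      rw [this, mul_one]
    · intro b' _ hb
      rw [E.weight_some_of_ne (by rwa [hv]), mul_zero]
    · simp

/-- A single variable of block `b` carries the whole power of `ε`; all other factors are taken at
position `0`. -/
lemma exists_expo_eq_of_lt (hr : ∀ b, 0 < E.r b) {ν : Option B →₀ ℕ} {b : B}
    (hb : ν (some b) ≠ 0) (hν : ν none < E.r b) : ∃ μ, E.expo μ = ν := by
  classical
  obtain ⟨v, hv, hv'⟩ := E.exists_var hν
  have hle : E.weight v ≤ ν := by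
    intro o
    cases o with
    | none => simp [hv']
    | some b' =>
      by_cases h : E.blk v = b'
      · subst h
        rw [weight_some_self, hv]
        omega
      · rw [E.weight_some_of_ne h]
        exact Nat.zero_le _
  obtain ⟨μ, hμ⟩ := E.exists_expo_eq hr (ν := ν - E.weight v) (by simp [hv'])
  refine ⟨Finsupp.single v 1 + μ, ?_⟩
  rw [map_add, expo_single, hμ, add_tsub_cancel_of_le hle]

/-- The exponents of block degree `t`, supported on `T` and with `ε`-degree below `ρ`, index a basis
of the image. For `t ≥ 1` some block is present to carry the power of `ε`; for `t = 0` only the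
constant is left. -/
theorem hilbertFunction_kerIdeal (hr : ∀ b, 0 < E.r b) {T : Set B} {ρ : ℕ}
    (hρ : ∀ b ∈ T, ρ ≤ E.r b) {t : ℕ} (ht : 1 ≤ t) :
    hilbertFunction (E.kerIdeal K T ρ) t = ρ * (t + T.ncard - 1).choose t := by
  classical
  obtain ⟨s, rfl⟩ := T.toFinite.exists_finset_coe
  let N := Fin ρ × s.finsuppAntidiag t
  let ex : N → Option B →₀ ℕ := fun n => (n.2 : B →₀ ℕ).optionElim (n.1 : ℕ)
  have ex_none : ∀ n, ex n none = n.1 := fun n => Finsupp.optionElim_apply_none _ _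
  have ex_some : ∀ n b, ex n (some b) = (n.2 : B →₀ ℕ) b :=
    fun n b => Finsupp.optionElim_apply_some _ _ _
  have ex_inj : Function.Injective ex := by
    intro n n' h
    refine Prod.ext (Fin.ext ?_) (Subtype.ext (Finsupp.ext fun b => ?_))
    · rw [← ex_none, ← ex_none, h]
    · rw [← ex_some, ← ex_some, h]
  have ex_supp : ∀ n, SupportedOn (s : Set B) (ex n) := fun n b hb => by
    rw [ex_some] at hb
    exact (Finset.mem_finsuppAntidiag.1 n.2.2).2 (Finsupp.mem_support_iff.2 hb)
  have ex_deg : ∀ n, blockDegree (ex n) = t := fun n => by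
    obtain ⟨h1, h2⟩ := Finset.mem_finsuppAntidiag.1 n.2.2
    rw [blockDegree_apply, ← h1]
    simp only [ex_some]
    refine (Finset.sum_subset (Finset.subset_univ s) fun b _ hb => ?_).symm
    exact Finsupp.notMem_support_iff.1 fun h => hb (h2 h)
  have ex_surj : ∀ ν, SupportedOn (s : Set B) ν → ν none < ρ → blockDegree ν = t →
      ∃ n, ex n = ν := fun ν h1 h2 h3 => by
    have hsub : ν.some.support ⊆ s := fun b hb => h1 b (by
      rwa [Finsupp.mem_support_iff, Finsupp.some_apply] at hb)
    refine ⟨(⟨ν none, h2⟩, ⟨ν.some, Finset.mem_finsuppAntidiag.2 ⟨?_, hsub⟩⟩), ?_⟩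
    · rw [← h3, blockDegree_apply]
      refine Finset.sum_subset (Finset.subset_univ s) fun b _ hb => ?_
      exact Finsupp.notMem_support_iff.1 fun h => hb (hsub h)
    · ext o
      cases o with
      | none => rw [ex_none]
      | some b => rw [ex_some]; rfl
  -- On forms of degree `t` the kernel of `L` is the ideal, and `L` is onto since each exponent is
  -- attained by a monomial.
  let L : MvPolynomial V K →ₗ[K] (N → K) :=
    LinearMap.pi fun n => lcoeff K (ex n) ∘ₗ (E.param K).toLinearMap
  have hL : ∀ f n, L f n = coeff (ex n) (E.param K f) := fun f n => rfl
  rw [hilbertFunction_eq_finrank_map _ t L]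
  · have htop : (homogeneousSubmodule V K t).map L = ⊤ := by
      rw [eq_top_iff]
      intro g _
      have hg : g = ∑ n, g n • Pi.single n 1 := by
        ext m
        rw [Finset.sum_apply, Finset.sum_eq_single m]
        · simp
        · intro n _ hn
          simp [hn.symm]
        · simp
      rw [hg]
      refine Submodule.sum_mem _ fun n _ => Submodule.smul_mem _ _ ?_
      obtain ⟨b, hb⟩ : ∃ b, ex n (some b) ≠ 0 := by
        by_contra! h
        have := ex_deg n
        rw [blockDegree_apply, Finset.sum_eq_zero fun b _ => h b] at this
        omega
      obtain ⟨μ, hμ⟩ := E.exists_expo_eq_of_lt hr hb (by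
        rw [ex_none]
        exact n.1.2.trans_le (hρ b (ex_supp n b hb)))
      refine ⟨monomial μ 1, isHomogeneous_monomial _ ?_, ?_⟩
      · rw [← E.blockDegree_expo, hμ, ex_deg]
      · ext m
        rw [hL, param_monomial, hμ, coeff_monomial, Pi.single_apply]
        simp only [ex_inj.eq_iff, eq_comm]
    rw [htop, finrank_top, Module.finrank_fintype_fun_eq_card, Fintype.card_prod,
      Fintype.card_fin, Fintype.card_coe, Finset.card_finsuppAntidiag_nat_eq_choose,
      Set.ncard_coe_finset, add_comm t]
  · intro f hf
    rw [mem_kerIdeal]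
    constructor
    · intro h
      ext n
      exact h _ (ex_supp n) (by rw [ex_none]; exact n.1.2)
    · intro h ν h1 h2
      by_cases h3 : blockDegree ν = t
      · obtain ⟨n, rfl⟩ := ex_surj ν h1 h2 h3
        exact congrFun h n
      · have := E.coeff_param_homogeneousComponent f t ν
        rwa [homogeneousComponent_of_mem hf, if_pos rfl, if_neg h3] at this

end BlockFrame

lemma BlockType.ncard_headBlocks (S : BlockType) (j : Fin S.len) :
    (S.headBlocks j).ncard = ∑ m ∈ Finset.Iic j, S.k m := by
  have : S.headBlocks j = ((Finset.Iic j).sigma fun a => (Finset.univ : Finset (Fin (S.k a))) :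
      Finset S.Block) := by
    ext b
    simp [headBlocks]
  rw [this, Set.ncard_coe_finset, Finset.card_sigma]
  simp

namespace JordanData

variable {K : Type*} [Field K] (D : JordanData K) (c : D.Comp)

lemma component_isHomogeneous : IsHomogeneousIdeal (D.component c) := by
  rw [component_eq_kerIdeal]
  exact D.frame.kerIdeal_isHomogeneous _ _

lemma hilbertFunction_component_zero : hilbertFunction (D.component c) 0 = 1 := by
  rw [component_eq_kerIdeal]
  exact hilbertFunction_zero (D.frame.one_notMem_kerIdeal _ ((D.type c.1).r_pos c.2))

lemma hilbertFunction_q_zero : hilbertFunction (D.q c) 0 = 1 := by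
  rw [q, BlockType.q_eq_kerIdeal]
  exact hilbertFunction_zero ((D.type c.1).frame.one_notMem_kerIdeal _ ((D.type c.1).r_pos c.2))

lemma hilbertFunction_component {t : ℕ} (ht : 1 ≤ t) : hilbertFunction (D.component c) t =
    (D.type c.1).r c.2 * (t + (∑ m ∈ Finset.Iic c.2, (D.type c.1).k m) - 1).choose t := by
  rw [component_eq_kerIdeal, BlockFrame.hilbertFunction_kerIdeal _ D.frame_r_pos _ ht, headBlocks,
    Set.ncard_image_of_injective _ sigma_mk_injective, BlockType.ncard_headBlocks]
  rintro _ ⟨b, hb, rfl⟩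
  exact (D.type c.1).r_anti.antitone hb

lemma hilbertFunction_q {t : ℕ} (ht : 1 ≤ t) : hilbertFunction (D.q c) t =
    (D.type c.1).r c.2 * (t + (∑ m ∈ Finset.Iic c.2, (D.type c.1).k m) - 1).choose t := by
  rw [q, BlockType.q_eq_kerIdeal, BlockFrame.hilbertFunction_kerIdeal _ _ _ ht,
    BlockType.ncard_headBlocks]
  · exact fun b => (D.type c.1).r_pos b.1
  · exact fun b hb => (D.type c.1).r_anti.antitone hb

lemma hilbertFunction_component_eq (t : ℕ) :
    hilbertFunction (D.component c) t = hilbertFunction (D.q c) t := by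
  rcases Nat.eq_zero_or_pos t with rfl | ht
  · rw [hilbertFunction_component_zero, hilbertFunction_q_zero]
  · rw [D.hilbertFunction_component c ht, D.hilbertFunction_q c ht]

end JordanData

/-! ### Linear changes of variables -/

section LinearSubstitution

variable {K ι κ τ : Type*} [Field K] [Fintype κ] [Fintype τ]

/-- The linear form with given coefficients. -/
def linearForm (a : κ → K) : MvPolynomial κ K := ∑ i, C (a i) * X i

/-- The linear substitution `x = P y`. -/
def linearSubst (P : Matrix ι κ K) : MvPolynomial ι K →ₐ[K] MvPolynomial κ K :=
  aeval fun i => linearForm (P i)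

lemma linearSubst_X (P : Matrix ι κ K) (i : ι) : linearSubst P (X i) = linearForm (P i) := by
  simp [linearSubst]

lemma linearSubst_C (P : Matrix ι κ K) (a : K) : linearSubst P (C a) = C a :=
  (linearSubst P).commutes a

lemma sum_C_mul_linearForm (a : κ → K) (P : Matrix κ τ K) :
    ∑ i, C (a i) * linearForm (P i) = linearForm (Matrix.vecMul a P) := by
  simp only [linearForm, Finset.mul_sum, Matrix.vecMul, dotProduct, map_sum, map_mul,
    Finset.sum_mul, mul_assoc]
  exact Finset.sum_comm

lemma linearSubst_linearForm (P : Matrix κ τ K) (a : κ → K) :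
    linearSubst P (linearForm a) = linearForm (Matrix.vecMul a P) := by
  rw [← sum_C_mul_linearForm, linearForm, map_sum]
  simp only [map_mul, linearSubst_X, linearSubst_C]

lemma linearSubst_linearSubst (P : Matrix ι κ K) (Q : Matrix κ τ K) (f : MvPolynomial ι K) :
    linearSubst Q (linearSubst P f) = linearSubst (P * Q) f := by
  have : (linearSubst Q).comp (linearSubst P) = linearSubst (P * Q) := by
    ext1 i
    rw [AlgHom.comp_apply, linearSubst_X, linearSubst_X, linearSubst_linearForm]
    rfl
  exact DFunLike.congr_fun this f

lemma linearSubst_one [DecidableEq κ] (f : MvPolynomial κ K) :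
    linearSubst (1 : Matrix κ κ K) f = f := by
  have : linearSubst (1 : Matrix κ κ K) = AlgHom.id K _ := by
    ext1 i
    rw [linearSubst_X, linearForm, Finset.sum_eq_single i]
    · simp
    · intro j _ hj
      rw [Matrix.one_apply_ne hj.symm, map_zero, zero_mul]
    · simp
  rw [this, AlgHom.id_apply]

lemma linearForm_isHomogeneous (a : κ → K) : (linearForm a).IsHomogeneous 1 :=
  IsHomogeneous.sum _ _ _ fun i _ => by
    simpa using (isHomogeneous_C κ (a i)).mul (isHomogeneous_X K i)

lemma linearSubst_isHomogeneous (P : Matrix ι κ K) {f : MvPolynomial ι K} {t : ℕ}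
    (hf : f.IsHomogeneous t) : (linearSubst P f).IsHomogeneous t := by
  have := hf.aeval _ fun i => linearForm_isHomogeneous (P i)
  rwa [one_mul] at this

lemma eigenIdeal_le_comap_linearSubst [Fintype ι] {A : Matrix ι ι K} {M : Matrix κ κ K}
    {P : Matrix ι κ K} (h : A * P = P * M) :
    eigenIdeal A ≤ (eigenIdeal M).comap (linearSubst P) := by
  rw [eigenIdeal_le_iff]
  intro p q
  have hrow : ∀ i, linearSubst P (linearForm (A i)) = ∑ v, C (P i v) * linearForm (M v) := by
    intro i
    rw [linearSubst_linearForm, sum_C_mul_linearForm]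
    exact congrArg linearForm (congrFun h i)
  change linearSubst P (linearForm (A p) * X q - X p * linearForm (A q)) ∈ eigenIdeal M
  -- Since `A P = P M`, both columns of `(A x | x)` are `P` times the columns of `(M y | y)`; minors
  -- are bilinear in the two rows.
  have key : linearSubst P (linearForm (A p) * X q - X p * linearForm (A q)) =
      ∑ u, ∑ v, C (P p u) * C (P q v) * (linearForm (M u) * X v - X u * linearForm (M v)) := by
    rw [map_sub, map_mul, map_mul, hrow, hrow, linearSubst_X, linearSubst_X, linearForm,
      linearForm, Finset.sum_mul_sum, Finset.sum_mul_sum, ← Finset.sum_sub_distrib]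
    refine Finset.sum_congr rfl fun u _ => ?_
    rw [← Finset.sum_sub_distrib]
    exact Finset.sum_congr rfl fun v _ => by ring
  rw [key]
  exact Ideal.sum_mem _ fun u _ => Ideal.sum_mem _ fun v _ =>
    Ideal.mul_mem_left _ _ (minor_mem_eigenIdeal M u v)

end LinearSubstitution

theorem IsIrredundantPrimaryDecomposition.comap {R R' κ : Type*} [CommRing R] [CommRing R']
    {I : Ideal R'} {Q : κ → Ideal R'} (h : IsIrredundantPrimaryDecomposition I Q) (f : R →+* R')
    (hf : Function.Surjective f) :
    IsIrredundantPrimaryDecomposition (I.comap f) fun a => (Q a).comap f where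
  eq_iInf := by rw [h.eq_iInf, Ideal.comap_iInf]
  primary a := (h.primary a).comap f
  irredundant a hle := h.irredundant a (by
    simp only [← Ideal.comap_iInf] at hle
    exact (Ideal.comap_le_comap_iff_of_surjective f hf _ _).1 hle)
  radical_injective a b hab := h.radical_injective (by
    simp only [← Ideal.comap_radical] at hab
    exact Ideal.comap_injective_of_surjective f hf hab)

namespace JordanForm

variable {K ι : Type*} [Field K] [Fintype ι] [DecidableEq ι] {A : Matrix ι ι K}
  (F : JordanForm A)

lemma changeOfVars_eq : F.changeOfVars = linearSubst F.P := rfl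

lemma changeOfVars_linearSubst (f : MvPolynomial F.data.Index K) :
    F.changeOfVars (linearSubst F.Pinv f) = f := by
  rw [changeOfVars_eq, linearSubst_linearSubst, F.inv_mul, linearSubst_one]

lemma linearSubst_changeOfVars (f : MvPolynomial ι K) :
    linearSubst F.Pinv (F.changeOfVars f) = f := by
  rw [changeOfVars_eq, linearSubst_linearSubst, F.mul_inv, linearSubst_one]

lemma changeOfVars_surjective : Function.Surjective F.changeOfVars :=
  fun f => ⟨_, F.changeOfVars_linearSubst f⟩

lemma eigenIdeal_eq_comap :
    eigenIdeal A = (eigenIdeal F.data.matrix).comap F.changeOfVars := by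
  apply le_antisymm
  · refine eigenIdeal_le_comap_linearSubst ?_
    rw [← F.conj, ← Matrix.mul_assoc, ← Matrix.mul_assoc, F.mul_inv, Matrix.one_mul]
  · intro f hf
    have h : F.data.matrix * F.Pinv = F.Pinv * A := by
      rw [← F.conj, Matrix.mul_assoc, F.mul_inv, Matrix.mul_one]
    have := eigenIdeal_le_comap_linearSubst h hf
    rwa [Ideal.mem_comap, linearSubst_changeOfVars] at this

theorem isIrredundantPrimaryDecomposition :
    IsIrredundantPrimaryDecomposition (eigenIdeal A) F.component := by
  rw [eigenIdeal_eq_comap]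
  exact F.data.isIrredundantPrimaryDecomposition.comap F.changeOfVars.toRingHom
    F.changeOfVars_surjective

theorem hilbertFunction_component (c : F.data.Comp) (t : ℕ) :
    hilbertFunction (F.component c) t = hilbertFunction (F.data.component c) t := by
  rw [hilbertFunction_eq_finrank_map (F.component c) t
    ((Ideal.Quotient.mkₐ K (F.data.component c)).toLinearMap ∘ₗ F.changeOfVars.toLinearMap),
    Submodule.map_comp, hilbertFunction]
  · have h : (homogeneousSubmodule ι K t).map F.changeOfVars.toLinearMap =
        homogeneousSubmodule F.data.Index K t := by
      apply le_antisymm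
      · rintro _ ⟨f, hf, rfl⟩
        exact linearSubst_isHomogeneous _ hf
      · intro f hf
        exact ⟨_, linearSubst_isHomogeneous F.Pinv hf, F.changeOfVars_linearSubst f⟩
    rw [h]
  · intro f _
    change F.changeOfVars f ∈ F.data.component c ↔
      Ideal.Quotient.mk (F.data.component c) (F.changeOfVars f) = 0
    rw [Ideal.Quotient.eq_zero_iff_mem]

theorem radicalsComparable_iff (c c' : F.data.Comp) :
    RadicalsComparable (F.component c) (F.component c') ↔ c.1 = c'.1 := by
  rw [← F.data.radicalsComparable_iff, RadicalsComparable, RadicalsComparable, component, component,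
    ← Ideal.comap_radical, ← Ideal.comap_radical]
  have h := fun I J => Ideal.comap_le_comap_iff_of_surjective F.changeOfVars.toRingHom
    F.changeOfVars_surjective I J
  exact or_congr (h _ _) (h _ _)

end JordanForm

/-! ### Recovering the Jordan type -/

lemma mul_choose_two (n : ℕ) : 2 * (n + 1).choose 2 = n * (n + 1) := by
  rw [Nat.choose_two_right, Nat.mul_div_cancel' (Nat.even_mul_pred_self (n + 1)).two_dvd,
    Nat.add_sub_cancel, mul_comm]

/-- Degree 1 gives `r k` and degree 2 gives `r k (k + 1) / 2`; dividing yields `k + 1`, then `r`. -/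
lemma eq_of_mul_choose_eq {r r' k k' : ℕ} (hr : 0 < r) (hk : 0 < k)
    (h1 : r' * (1 + k' - 1).choose 1 = r * (1 + k - 1).choose 1)
    (h2 : r' * (2 + k' - 1).choose 2 = r * (2 + k - 1).choose 2) : r' = r ∧ k' = k := by
  rw [show 1 + k' - 1 = k' by omega, show 1 + k - 1 = k by omega, Nat.choose_one_right,
    Nat.choose_one_right] at h1
  rw [show 2 + k' - 1 = k' + 1 by omega, show 2 + k - 1 = k + 1 by omega] at h2
  have h3 : (r * k) * (k' + 1) = (r * k) * (k + 1) := by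
    have := congrArg (2 * ·) h2
    simp only [mul_left_comm 2, mul_choose_two] at this
    rw [← mul_assoc, ← mul_assoc, h1] at this
    exact this
  have hkk : k' = k := Nat.succ_injective (Nat.eq_of_mul_eq_mul_left (Nat.mul_pos hr hk) h3)
  subst hkk
  exact ⟨Nat.eq_of_mul_eq_mul_right hk h1, rfl⟩

lemma eq_of_sum_Iic_eq {m : ℕ} {k k' : Fin m → ℕ}
    (h : ∀ j, ∑ a ∈ Finset.Iic j, k' a = ∑ a ∈ Finset.Iic j, k a) (j : Fin m) : k' j = k j := by
  induction j using WellFoundedLT.induction with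
  | _ j ih =>
    have hj := h j
    rw [Finset.Iic_eq_cons_Iio, Finset.sum_cons, Finset.sum_cons,
      Finset.sum_congr rfl fun a ha => ih a (Finset.mem_Iio.1 ha)] at hj
    exact Nat.add_right_cancel hj

namespace BlockType

lemma k_eq_of_sum_eq {S S' : BlockType} (hl : S.len = S'.len)
    (h : ∀ j, ∑ a ∈ Finset.Iic (Fin.cast hl j), S'.k a = ∑ a ∈ Finset.Iic j, S.k a)
    (j : Fin S.len) : S'.k (Fin.cast hl j) = S.k j := by
  obtain ⟨l, k, r, _, _, _, _⟩ := S
  obtain ⟨l', k', r', _, _, _, _⟩ := S'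
  dsimp only at hl
  subst hl
  exact eq_of_sum_Iic_eq h j

lemma eq_of_forall {S S' : BlockType} (hl : S.len = S'.len)
    (hk : ∀ j, S'.k (Fin.cast hl j) = S.k j) (hr : ∀ j, S'.r (Fin.cast hl j) = S.r j) :
    S = S' := by
  obtain ⟨l, k, r, _, _, _, _⟩ := S
  obtain ⟨l', k', r', _, _, _, _⟩ := S'
  dsimp only at hl
  subst hl
  obtain rfl : k' = k := funext hk
  obtain rfl : r' = r := funext hr
  rfl

lemma matrix_cast {K : Type*} [Field K] {S S' : BlockType} (h : S = S') (lam : K)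
    (u v : S.Index) :
    S'.matrix lam (Equiv.cast (congrArg Index h) u) (Equiv.cast (congrArg Index h) v) =
      S.matrix lam u v := by
  subst h
  rfl

end BlockType

namespace JordanData

variable {K : Type*} [Field K] {D D' : JordanData K}

theorem exists_reindex_matrix (σ : Fin D.n ≃ Fin D'.n) (htype : ∀ i, D.type i = D'.type (σ i))
    (hlam : ∀ i, D'.eigenvalue (σ i) = D.eigenvalue i) :
    ∃ π : D.Index ≃ D'.Index, D'.matrix = Matrix.reindex π π D.matrix := by
  let π : D.Index ≃ D'.Index :=
    Equiv.sigmaCongr σ fun i => Equiv.cast (congrArg BlockType.Index (htype i))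
  have hπ : ∀ i u, π ⟨i, u⟩ = ⟨σ i, Equiv.cast (congrArg BlockType.Index (htype i)) u⟩ :=
    fun i u => rfl
  refine ⟨π, ?_⟩
  suffices h : ∀ u v, D'.matrix (π u) (π v) = D.matrix u v by
    ext u v
    rw [Matrix.reindex_apply, Matrix.submatrix_apply, ← h, Equiv.apply_symm_apply,
      Equiv.apply_symm_apply]
  rintro ⟨i, u⟩ ⟨i', v⟩
  rw [hπ, hπ]
  by_cases h : i = i'
  · subst h
    rw [matrix, matrix, Matrix.blockDiagonal'_apply_eq, Matrix.blockDiagonal'_apply_eq, hlam,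
      BlockType.matrix_cast (htype i)]
  · rw [matrix, matrix, Matrix.blockDiagonal'_apply_ne _ _ _ h,
      Matrix.blockDiagonal'_apply_ne _ _ _ (σ.injective.ne h)]

lemma sum_k_pos (c : D.Comp) : 0 < ∑ m ∈ Finset.Iic c.2, (D.type c.1).k m :=
  Finset.sum_pos (fun m _ => (D.type c.1).k_pos m) ⟨c.2, by simp⟩

/-- The bijection of the eigenvalues induced by a bijection of the components that preserves the
eigenvalue classes. -/
def eigenvalueEquiv (e : D.Comp ≃ D'.Comp) (he : ∀ c d, (e c).1 = (e d).1 ↔ c.1 = d.1) :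
    Fin D.n ≃ Fin D'.n where
  toFun i := (e ⟨i, ⟨0, (D.type i).len_pos⟩⟩).1
  invFun i := (e.symm ⟨i, ⟨0, (D'.type i).len_pos⟩⟩).1
  left_inv i := by
    have := he (e.symm ⟨(e ⟨i, ⟨0, (D.type i).len_pos⟩⟩).1, ⟨0, (D'.type _).len_pos⟩⟩)
      ⟨i, ⟨0, (D.type i).len_pos⟩⟩
    exact this.1 (by rw [Equiv.apply_symm_apply])
  right_inv i := by
    have := he ⟨(e.symm ⟨i, ⟨0, (D'.type i).len_pos⟩⟩).1, ⟨0, (D.type _).len_pos⟩⟩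
      (e.symm ⟨i, ⟨0, (D'.type i).len_pos⟩⟩)
    rw [Equiv.apply_symm_apply] at this
    exact this.2 rfl

lemma fst_apply_eq (e : D.Comp ≃ D'.Comp) (he : ∀ c d, (e c).1 = (e d).1 ↔ c.1 = d.1)
    (c : D.Comp) : (e c).1 = eigenvalueEquiv e he c.1 :=
  (he _ _).2 rfl

/-- A bijection of the components that preserves the eigenvalue classes and the numerical
invariants of the components comes from a bijection of the eigenvalues. -/
theorem exists_equiv_of_comp_equiv (e : D.Comp ≃ D'.Comp)
    (he : ∀ c d, (e c).1 = (e d).1 ↔ c.1 = d.1)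
    (hr : ∀ c, (D'.type (e c).1).r (e c).2 = (D.type c.1).r c.2)
    (hk : ∀ c, ∑ m ∈ Finset.Iic (e c).2, (D'.type (e c).1).k m =
      ∑ m ∈ Finset.Iic c.2, (D.type c.1).k m) :
    ∃ (σ : Fin D.n ≃ Fin D'.n) (hl : ∀ i, (D.type i).len = (D'.type (σ i)).len),
      ∀ i j, e ⟨i, j⟩ = ⟨σ i, Fin.cast (hl i) j⟩ ∧
        (D'.type (σ i)).k (Fin.cast (hl i) j) = (D.type i).k j ∧
        (D'.type (σ i)).r (Fin.cast (hl i) j) = (D.type i).r j := by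
  let σ := eigenvalueEquiv e he
  have hex : ∀ i j, ∃ j', e ⟨i, j⟩ = ⟨σ i, j'⟩ := by
    intro i j
    have h := fst_apply_eq e he ⟨i, j⟩
    generalize e ⟨i, j⟩ = x at h
    obtain ⟨i', j'⟩ := x
    dsimp only at h
    subst h
    exact ⟨j', rfl⟩
  choose g hg using hex
  have hgr : ∀ i j, (D'.type (σ i)).r (g i j) = (D.type i).r j := fun i j => by
    have := hr ⟨i, j⟩
    rwa [hg] at this
  have hgk : ∀ i j, ∑ m ∈ Finset.Iic (g i j), (D'.type (σ i)).k m =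
      ∑ m ∈ Finset.Iic j, (D.type i).k m := fun i j => by
    have := hk ⟨i, j⟩
    rwa [hg] at this
  -- Both size sequences decrease strictly and `g i` preserves sizes, so it preserves the order.
  -- Being also surjective, it must be the identity up to a cast.
  have hmono : ∀ i, StrictMono (g i) := fun i j j' hj => by
    have := (D.type i).r_anti hj
    rw [← hgr, ← hgr] at this
    exact (D'.type (σ i)).r_anti.lt_iff_gt.1 this
  have hsurj : ∀ i, Function.Surjective (g i) := fun i j' => by
    obtain ⟨⟨i', j⟩, hc⟩ := e.surjective ⟨σ i, j'⟩
    have h := hg i' j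
    rw [hc] at h
    obtain rfl : i = i' := σ.injective (Sigma.mk.inj h).1
    exact ⟨j, (eq_of_heq (Sigma.mk.inj h).2).symm⟩
  have hl : ∀ i, (D.type i).len = (D'.type (σ i)).len := fun i => by
    simpa using Fintype.card_of_bijective ⟨(hmono i).injective, hsurj i⟩
  have hcast : ∀ i, g i = Fin.cast (hl i) := fun i => by
    refine (StrictMono.range_inj (hmono i) (fun a b h => h)).1 ?_
    rw [(hsurj i).range_eq, (Fin.rightInverse_cast (hl i)).surjective.range_eq]
  simp only [hcast] at hg hgr hgk
  exact ⟨σ, hl, fun i j => ⟨hg i j, BlockType.k_eq_of_sum_eq (hl i) (hgk i) j, hgr i j⟩⟩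

end JordanData

end Eigenscheme

end

open Eigenscheme in
theorem mainTheorem4 {K : Type*} [Field K] :
    -- the irredundant primary decomposition of the ideal of a Jordan matrix
    (∀ D : JordanData K,
      IsIrredundantPrimaryDecomposition (eigenIdeal D.matrix) D.component ∧
      -- the Hilbert functions of its components
      (∀ c : D.Comp,
        IsHomogeneousIdeal (D.component c) ∧
        (∀ t : ℕ, hilbertFunction (D.component c) t = hilbertFunction (D.q c) t) ∧
        hilbertFunction (D.component c) 0 = 1 ∧
        ∀ t : ℕ, 1 ≤ t → hilbertFunction (D.component c) t =
          (D.type c.1).r c.2 *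
            Nat.choose (t + (∑ m ∈ Finset.Iic c.2, (D.type c.1).k m) - 1) t) ∧
      -- components belong to the same eigenvalue iff their radicals are comparable
      (∀ c c' : D.Comp, RadicalsComparable (D.component c) (D.component c') ↔ c.1 = c'.1)) ∧
    -- the decomposition of the ideal of a matrix with a given Jordan canonical form
    (∀ (s : ℕ) (A : Matrix (Fin s) (Fin s) K) (F : JordanForm A),
      IsIrredundantPrimaryDecomposition (eigenIdeal A) F.component ∧
      ∀ (c : F.data.Comp) (t : ℕ),
        hilbertFunction (F.component c) t = hilbertFunction (F.data.component c) t) ∧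
    -- the Hilbert functions of the components and the comparability of their radicals
    -- determine the Jordan canonical form, up to the values and the order of the eigenvalues
    (∀ (s s' : ℕ) (A : Matrix (Fin s) (Fin s) K) (A' : Matrix (Fin s') (Fin s') K)
      (F : JordanForm A) (F' : JordanForm A') (e : F.data.Comp ≃ F'.data.Comp),
      (∀ c t, hilbertFunction (F'.component (e c)) t = hilbertFunction (F.component c) t) →
      (∀ c d, RadicalsComparable (F'.component (e c)) (F'.component (e d)) ↔
        RadicalsComparable (F.component c) (F.component d)) →
      ∃ (σ : Fin F.data.n ≃ Fin F'.data.n)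
        (hl : ∀ i, (F.data.type i).len = (F'.data.type (σ i)).len),
        (∀ i j, e ⟨i, j⟩ = ⟨σ i, Fin.cast (hl i) j⟩ ∧
          (F'.data.type (σ i)).k (Fin.cast (hl i) j) = (F.data.type i).k j ∧
          (F'.data.type (σ i)).r (Fin.cast (hl i) j) = (F.data.type i).r j) ∧
        ((∀ i, F'.data.eigenvalue (σ i) = F.data.eigenvalue i) →
          ∃ π : F.data.Index ≃ F'.data.Index,
            F'.data.matrix = Matrix.reindex π π F.data.matrix)) := by
  refine ⟨fun D => ⟨D.isIrredundantPrimaryDecomposition, fun c => ⟨D.component_isHomogeneous c,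
    D.hilbertFunction_component_eq c, D.hilbertFunction_component_zero c,
    fun t ht => D.hilbertFunction_component c ht⟩, D.radicalsComparable_iff⟩,
    fun s A F => ⟨F.isIrredundantPrimaryDecomposition, F.hilbertFunction_component⟩, ?_⟩
  intro s s' A A' F F' e hH hC
  have hrk := fun c => by
    have h := fun t => hH c t
    simp only [JordanForm.hilbertFunction_component] at h
    have h1 := h 1
    have h2 := h 2
    rw [JordanData.hilbertFunction_component _ _ le_rfl,
      JordanData.hilbertFunction_component _ _ le_rfl] at h1
    rw [JordanData.hilbertFunction_component _ _ one_le_two,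
      JordanData.hilbertFunction_component _ _ one_le_two] at h2
    exact eq_of_mul_choose_eq ((F.data.type c.1).r_pos c.2) (JordanData.sum_k_pos c) h1 h2
  obtain ⟨σ, hl, h⟩ := JordanData.exists_equiv_of_comp_equiv e
    (fun c d => by
      rw [← F.radicalsComparable_iff, ← F'.radicalsComparable_iff]
      exact hC c d)
    (fun c => (hrk c).1) fun c => (hrk c).2
  exact ⟨σ, hl, h, JordanData.exists_reindex_matrix σ fun i =>
    BlockType.eq_of_forall (hl i) (fun j => (h i j).2.1) fun j => (h i j).2.2⟩
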